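/- **Theorem (The Lifting Theorem).** *Setting.* Let $\mathbb F_q$ be a finite field, $1\le K\le N$, $1\le T\le N$, $0\le r<N$, $M\ge 2$. Each message $W^1,\dots,W^M\in\mathbb F_q^{L}$ with $K\mid L$ is cut into $K$ pieces in $\mathbb F_q^{L/K}$ and stored on $N$ servers with a fixed linear $(N,K)$-MDS code with generator matrix $G\in\mathbb F_q^{K\times N}$ (any $K$ columns linearly independent): server $i$ stores $D_i=(W^1_i,\dots,W^M_i)\in\mathbb F_q^{ML/K}$, where $W^j_i$ is the combination of the $K$ pieces of $W^j$ with coefficients from column $i$ of $G$. A query to server $i$ is a vector $q\in\mathbb F_q^{ML/K}$; the response is $\langle D_i,q\rangle$, regarded as a linear form in the messages. $\mathbb V_j$ denotes the space of queries which only involve message $j$, and a $k$-query is a sum of $k$ queries from $k$ different $\mathbb V_j$. A *PIR scheme* assigns to each desired index $m$ a joint law of the queries sent to the servers, their number per server not depending on $m$. With the messages independent and uniform, and independent of the queries, it is *correct* if for every $m$ the conditional entropy of $W^m$ given the queries and the responses is $0$, and *$T$-private* if, $m$ being uniform on $\{1,\dots,M\}$, the queries sent to any $T$ servers have zero mutual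 information with $m$. A correct and $T$-private scheme is an $(N,K,T,M)$-PIR scheme; its rate is $L$ divided by the total number of queries. An $(N,K,T,M)$-*one-shot scheme of codimension $r$* consists of random $q_1,\dots,q_N\in\mathbb F_q^{ML/K}$ and $a_{r+1},\dots,a_N\in\mathbb V_1$ such that, when $q_i$ is sent to server $i$ for $i\le r$ and $q_i+a_i$ for $i>r$: any $T$ of the queries sent are independent and uniform; the linear forms $\langle D_i,a_i\rangle$, $i>r$, are linearly independent; and there are fixed coefficients $\alpha^i_j$ with the decoding equations $\langle D_i,q_i\rangle=\sum_{j\le r}\alpha^i_j\langle D_j,q_j\rangle$ for $i>r$. Its rate is $(N-r)/N$. Replacing the noise servers $1,\dots,r$ by $c+1,\dots,c+r$ (indices modulo $N$) gives the notion of a one-shot scheme *shifted by $c$*. *Symbolic matrix.* $S_2=(1,\dots,1,2,\dots,2)$ with $r$ ones and $N-r$ twos. Let $\sigma$ rotate the columns of a matrix by one to the left. $S_{M+1}=\mathrm{lift}(S_M)$ consists of $S_M,\sigma(S_M),\dots,\sigma^{r-1}(S_M)$ stacked, followed by a matrix $A$ with one row for each entry of $S_M$ with value $M$, in lexicographic order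 of their positions; the row of the entry in column $j$ has zeros in the columns $j,j-1,\dots,j-r+1$ (modulo $N$) and $M+1$ elsewhere. So $S_M=\mathrm{lift}^{M-2}(S_2)$. It is built up from blocks, each with one entry in every column, equal to some $k$ in $r$ cyclically consecutive columns $c+1,\dots,c+r$ and to $k+1$ in the others: the row $S_2$ is a block ($k=1$, $c=0$), every copy $\sigma^s(S_M)$ inherits the blocks of $S_M$, and each row of $A$ forms a block with the entry of $S_M$ that it belongs to and the copies of this entry in $\sigma(S_M),\dots,\sigma^{r-1}(S_M)$. *Statement.* Let $\mathcal Q$ be an $(N,K,T,M)$-one-shot scheme of codimension $r$ for this code. If $K\ge2$ and $M\ge3$, assume that one-shot schemes of codimension $r$ shifted by $c$, with the same $N,K,T,M,L$ and the same code, exist for all $c$. Then there are decoding coefficients $\beta_c$, where $\beta_0$ are those of $\mathcal Q$ and, if $M\ge 3$, each $\beta_c$ are those of some one-shot scheme shifted by $c$, a number $\rho\ge 1$ and a PIR scheme $\mathcal Q'$ for messages of length $L'=\rho N^{M-1}$, with $K\mid L'$, stored with the same code, such that: 1. $\mathcal Q'$ has the query structure of $\rho$ repetitions of $S_M$: each nonzero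 entry $k$ in column $i$ stands for $\binom Mk$ $k$-queries to server $i$, one for every set of $k$ messages. 2. For desired index $m$, the responses to the $\mathbb V_m$-parts of all the queries that involve message $m$ are linearly independent. In every repetition, for every block, with parameters $k$ and $c$, and every set $I$ of $k$ messages other than $m$, let $x_i$ be the $k$-query for $I$ at the entry of the block in column $i$ if this entry is $k$, and the $(k+1)$-query for $I\cup\{m\}$ without its $\mathbb V_m$-part if it is $k+1$. Then the responses $\langle D_i,x_i\rangle$ satisfy the decoding equations with coefficients $\beta_c$. 3. $\mathcal Q'$ is correct and $T$-private, that is, an $(N,K,T,M)$-PIR scheme. 4. The rate of $\mathcal Q'$ is $$R=\frac{(N-r)N^{M-1}}{N^M-r^M}=\frac{N-r}{N\left(1-(r/N)^M\right)}>\frac{N-r}{N}.$$ -/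

import Mathlib

noncomputable section

/-! ### Coded storage and linear queries -/

/-- A generator matrix of an `(N, K)`-MDS code: any `K` columns are linearly independent. -/
def IsMDS {F : Type} [Field F] {N K : ℕ} (G : Matrix (Fin K) (Fin N) F) : Prop :=
  ∀ s : Finset (Fin N), s.card = K → LinearIndependent F (fun j : s => fun k => G k j)

/-- `M` messages in `F ^ L`, `L = K * ℓ`; each is cut into `K` pieces of length `ℓ = L / K`. -/
abbrev Database (F : Type) (M K ℓ : ℕ) : Type := Fin M → Fin K → Fin ℓ → F

/-- A linear query, an element of `F ^ (M * L / K)`; the coordinates are grouped by message. -/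
abbrev Query (F : Type) (M ℓ : ℕ) : Type := Fin M → Fin ℓ → F

/-- The data `D_j` stored on server `j`. -/
def stored {F : Type} [Field F] {N K M ℓ : ℕ} (G : Matrix (Fin K) (Fin N) F) (j : Fin N)
    (W : Database F M K ℓ) : Query F M ℓ :=
  fun m l => ∑ k, G k j * W m k l

/-- The response `⟨D_j, q⟩` of server `j` to the query `q`, as a linear form in the database. -/
def response {F : Type} [Field F] {N K M ℓ : ℕ} (G : Matrix (Fin K) (Fin N) F) (j : Fin N)
    (q : Query F M ℓ) : Database F M K ℓ →ₗ[F] F where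
  toFun W := ∑ m, ∑ l, stored G j W m l * q m l
  map_add' W W' := by
    simp only [stored, Pi.add_apply, mul_add, add_mul, Finset.sum_add_distrib]
  map_smul' a W := by
    simp only [stored, Pi.smul_apply, smul_eq_mul, RingHom.id_apply, Finset.mul_sum,
      Finset.sum_mul]
    refine Finset.sum_congr rfl fun m _ => Finset.sum_congr rfl fun l _ =>
      Finset.sum_congr rfl fun k _ => ?_
    ring

/-- The subspace `𝕍_m` of the queries which only query message `m`. -/
def onlyMessage (F : Type) [Field F] {M : ℕ} (ℓ : ℕ) (m : Fin M) : Submodule F (Query F M ℓ) where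
  carrier := {q | ∀ m', m' ≠ m → q m' = 0}
  add_mem' {a b} ha hb := fun m' h => by simp [ha m' h, hb m' h]
  zero_mem' := fun _ _ => rfl
  smul_mem' a q hq := fun m' h => by simp [hq m' h]

/-! ### Entropy on finite alphabets -/

/-- Shannon entropy. -/
def entropy {α : Type} [Fintype α] (p : PMF α) : ℝ := ∑ a, Real.negMulLog (p a).toReal

/-- `H(X | Y) = H(X, Y) - H(Y)`, for the joint law `p` of `(X, Y)`. -/
def condEntropy {α β : Type} [Fintype α] [Fintype β] (p : PMF (α × β)) : ℝ :=
  entropy p - entropy (p.map Prod.snd)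

/-- `I(X ; Y) = H(X) + H(Y) - H(X, Y)`, for the joint law `p` of `(X, Y)`. -/
def mutualInfo {α β : Type} [Fintype α] [Fintype β] (p : PMF (α × β)) : ℝ :=
  entropy (p.map Prod.fst) + entropy (p.map Prod.snd) - entropy p

/-! ### PIR schemes -/

/-- A scheme which sends to server `j` one query for each element of `ι j`: for every desired
message, the joint law of all queries. -/
abbrev Scheme (F : Type) {N : ℕ} (ι : Fin N → Type) (M ℓ : ℕ) : Type :=
  Fin M → PMF (∀ j, ι j → Query F M ℓ)

namespace Scheme

variable {F : Type} [Field F] [Fintype F] {N : ℕ} {ι : Fin N → Type}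
  [∀ j, Fintype (ι j)] [∀ j, DecidableEq (ι j)] {M ℓ : ℕ}

/-- Correctness: `H(W^m | A^m) = 0` for every desired message `m`. The messages are uniform and
independent of the queries; the user, who decodes, knows the queries that were sent. -/
def Correct {K : ℕ} (Q : Scheme F ι M ℓ) (G : Matrix (Fin K) (Fin N) F) : Prop :=
  ∀ m : Fin M,
    condEntropy ((PMF.uniformOfFintype (Database F M K ℓ)).bind fun W =>
      (Q m).map fun q => (W m, (q, fun (j : Fin N) (i : ι j) => response G j (q j i) W))) = 0

/-- `T`-privacy: the queries sent to any `T` servers have zero mutual information with the index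
of the desired message, which is uniformly distributed. -/
def TPrivate [NeZero M] (Q : Scheme F ι M ℓ) (T : ℕ) : Prop :=
  ∀ J : Finset (Fin N), J.card = T →
    mutualInfo ((PMF.uniformOfFintype (Fin M)).bind fun m =>
      (Q m).map fun q => ((fun (j : J) => q j), m)) = 0

/-- An `(N, K, T, M)`-PIR scheme on the storage code generated by `G`. -/
def IsPIR {K : ℕ} [NeZero M] (Q : Scheme F ι M ℓ) (G : Matrix (Fin K) (Fin N) F) (T : ℕ) : Prop :=
  Q.Correct G ∧ Q.TPrivate T

/-- The PIR rate: the message length `L = K * ℓ` over the number of downloaded symbols. -/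
def rate (_Q : Scheme F ι M ℓ) (K : ℕ) : ℝ :=
  ((K * ℓ : ℕ) : ℝ) / ((∑ j, Fintype.card (ι j) : ℕ) : ℝ)

end Scheme

/-! ### One-shot schemes -/

/-- The `r` noise servers `c, c + 1, …, c + r - 1` (cyclically). For `c = 0` these are the first
`r` servers. -/
def IsNoise {N : ℕ} [NeZero N] (r : ℕ) (c j : Fin N) : Prop := (j - c).val < r

instance {N : ℕ} [NeZero N] (r : ℕ) (c j : Fin N) : Decidable (IsNoise r c j) :=
  inferInstanceAs (Decidable ((j - c).val < r))

/-- An `(N, K, T, M)`-one-shot scheme of codimension `r` whose noise servers are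
`c, …, c + r - 1`; the usual one-shot schemes are those with `c = 0`. A point `(q, a)` of the
probability space gives the noise queries `q` and the informative queries `a` (of which only those
of the servers other than the noise servers are used). -/
structure OneShotScheme {F : Type} [Field F] [Fintype F] {N K : ℕ} [NeZero N]
    (G : Matrix (Fin K) (Fin N) F) (T r : ℕ) (c : Fin N) (M ℓ : ℕ) [NeZero M] where
  /-- the joint law of noise queries and informative queries -/
  law : PMF ((Fin N → Query F M ℓ) × (Fin N → Query F M ℓ))
  /-- the coefficients of the decoding equations -/
  coeff : Fin N → Fin N → F
  /-- the informative queries only query the first message -/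
  informative : ∀ ω ∈ law.support, ∀ i, ¬ IsNoise r c i → ω.2 i ∈ onlyMessage F ℓ (0 : Fin M)
  /-- any `T` of the queries sent are uniform and independent -/
  uniform : ∀ J : Finset (Fin N), J.card = T →
    law.map (fun ω (j : J) =>
        if IsNoise r c (j : Fin N) then ω.1 j else ω.1 j + ω.2 j) =
      PMF.uniformOfFintype (J → Query F M ℓ)
  /-- the responses to the informative queries are linearly independent -/
  independent : ∀ ω ∈ law.support,
    LinearIndependent F
      (fun i : {i : Fin N // ¬ IsNoise r c i} => response (K := K) G i (ω.2 i))
  /-- the decoding equations -/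
  decoding : ∀ ω ∈ law.support, ∀ i, ¬ IsNoise r c i →
    response G i (ω.1 i) =
      ∑ j ∈ Finset.univ.filter (fun j => IsNoise r c j), coeff i j • response G j (ω.1 j)

/-! ### Symbolic matrices -/

/-- A matrix with `N` columns and entries in `ℕ`, as the list of its rows. -/
abbrev SymMatrix (N : ℕ) : Type := List (Fin N → ℕ)

namespace SymMatrix

variable {N : ℕ} [NeZero N]

/-- The entry in row `i` and column `j`. -/
def entry (S : SymMatrix N) (i : ℕ) (j : Fin N) : ℕ := S.getD i (fun _ => 0) j

/-- The shift operation `σ`. -/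
def shift (S : SymMatrix N) : SymMatrix N := S.map fun row j => row (j + 1)

/-- The positions of the entries with value `k`, in lexicographical order. -/
def positions (k : ℕ) (S : SymMatrix N) : List (ℕ × Fin N) :=
  (List.range S.length).flatMap fun i =>
    ((List.finRange N).filter fun j => S.entry i j = k).map fun j => (i, j)

/-- The map `τ_l`, where `l` is a number of rows. -/
def tau (l : ℕ) (b : ℕ × Fin N) : ℕ × Fin N := (b.1 + l, b.2 - 1)

/-- The columns met by `B = {b, τ_l b, …, τ_l ^ (r - 1) b}`. -/
def columns (r l : ℕ) (b : ℕ × Fin N) : List (Fin N) :=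
  (List.range r).map fun s => ((tau l)^[s] b).2

/-- The lifting operation; `M` is the number of messages before the lifting. -/
def lift (r M : ℕ) (S : SymMatrix N) : SymMatrix N :=
  ((List.range r).flatMap fun s => shift^[s] S) ++
    (positions M S).map fun b j => if j ∈ columns r S.length b then 0 else M + 1

/-- The row `(1, …, 1, 2, …, 2)` with `r` ones. -/
def base (N r : ℕ) : SymMatrix N := [fun j => if j.val < r then 1 else 2]

/-- `lift ^ t (S_2) = S_{t + 2}`. -/
def iterLift (N r : ℕ) [NeZero N] : ℕ → SymMatrix N
  | 0 => base N r
  | t + 1 => lift r (t + 2) (iterLift N r t)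

/-- The symbolic matrix `S_M = lift ^ (M - 2) (S_2)`, for `M ≥ 2`. -/
def ofMessages (N r M : ℕ) [NeZero N] : SymMatrix N := iterLift N r (M - 2)

end SymMatrix

/-- A block of a symbolic matrix: one entry in every column, in row `row j` of column `j`. In the
columns `offset, …, offset + r - 1` the entry is `level`, in the other columns it is
`level + 1`. The lifting operation creates the symbolic matrix block by block. -/
structure Block (N : ℕ) where
  level : ℕ
  offset : Fin N
  row : Fin N → ℕ

namespace Block

variable {N : ℕ} [NeZero N]

/-- The image of a block of `S` in the copy `σ ^ s (S)` of `S` inside the lifted matrix. -/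
def copy (S : SymMatrix N) (s : ℕ) (b : Block N) : Block N where
  level := b.level
  offset := (fun c => c - 1)^[s] b.offset
  row j := s * S.length + b.row ((fun c => c + 1)^[s] j)

/-- The block formed by the set `B_a = {b, τ b, …, τ ^ (r - 1) b}` of entries with value `M` and
by the row number `a` of the matrix `A`, where `b` is entry number `a` with value `M`. -/
def new (S : SymMatrix N) (r M a : ℕ) (b : ℕ × Fin N) : Block N where
  level := M
  offset := (fun c => c - 1)^[r - 1] b.2
  row j := if (b.2 - j).val < r then (b.2 - j).val * S.length + b.1 else r * S.length + a

/-- The blocks of `lift ^ t (S_2)`. -/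
def iterLift (N r : ℕ) [NeZero N] : ℕ → List (Block N)
  | 0 => [⟨1, 0, fun _ => 0⟩]
  | t + 1 =>
    ((List.range r).flatMap fun s => (iterLift N r t).map (copy (SymMatrix.iterLift N r t) s)) ++
      (SymMatrix.positions (t + 2) (SymMatrix.iterLift N r t)).mapIdx
        (new (SymMatrix.iterLift N r t) r (t + 2))

/-- The blocks of `S_M`. -/
def ofMessages (N r M : ℕ) [NeZero N] : List (Block N) := iterLift N r (M - 2)

end Block

/-! ### Refined and lifted schemes -/

/-- The query structure of `ρ` repetitions of a symbolic matrix: the queries sent to server `j`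
are indexed by a repetition, a row with a nonzero entry `k` in column `j`, and a set of `k`
messages. -/
abbrev Slot {N : ℕ} (S : SymMatrix N) (M ρ : ℕ) (j : Fin N) : Type :=
  {x : Fin ρ × Fin S.length × Finset (Fin M) //
    x.2.2.Nonempty ∧ x.2.2.card = S.entry x.2.1 j}

/-- A sum of queries, one in each `𝕍_m` with `m ∈ I`. -/
def IsSumQuery {F : Type} [Field F] {M ℓ : ℕ} (I : Finset (Fin M)) (q : Query F M ℓ) : Prop :=
  ∃ v : Fin M → Query F M ℓ, (∀ m ∈ I, v m ∈ onlyMessage F ℓ m) ∧ q = ∑ m ∈ I, v m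

/-- `Q` interprets (`ρ` repetitions of) the symbolic matrix `S_M`, with the decoding equations
whose coefficients are `β c` for noise servers `c, …, c + r - 1`. Let `m` be the desired message.
* Each entry `k` stands for one `k`-query for every set of `k` messages.
* The responses to the parts in `𝕍_m` of all the queries that involve the desired message `m` are
  linearly independent.
* For every block of the matrix, of level `k` and offset `c`, and
  for every set `I` of `k` other messages, the queries for `I` in the noise servers of the block
  (the leftovers) and the noise parts of the queries for `I ∪ {m}` in its other servers satisfy
  the decoding equations with coefficients `β c`. -/
def IsLifted {F : Type} [Field F] {N K : ℕ} [NeZero N] (G : Matrix (Fin K) (Fin N) F)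
    (r M ℓ ρ : ℕ) (β : Fin N → Fin N → Fin N → F)
    (Q : Scheme F (Slot (SymMatrix.ofMessages N r M) M ρ) M ℓ) : Prop :=
  (∀ m, ∀ q ∈ (Q m).support, ∀ j (x : Slot (SymMatrix.ofMessages N r M) M ρ j),
    IsSumQuery x.1.2.2 (q j x)) ∧
  (∀ m, ∀ q ∈ (Q m).support,
    LinearIndependent F
      (fun x : {x : (Σ j, Slot (SymMatrix.ofMessages N r M) M ρ j) // m ∈ x.2.1.2.2} =>
        response (K := K) G x.1.1 (Pi.single m (q x.1.1 x.1.2 m)))) ∧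
  (∀ m, ∀ q ∈ (Q m).support, ∀ B ∈ Block.ofMessages N r M, ∀ (p : Fin ρ) (I : Finset (Fin M)),
    m ∉ I → I.card = B.level →
    ∀ x : (∀ j, Slot (SymMatrix.ofMessages N r M) M ρ j),
      (∀ j, (x j).1.1 = p ∧ ((x j).1.2.1 : ℕ) = B.row j ∧
        (x j).1.2.2 = if IsNoise r B.offset j then I else insert m I) →
      ∀ i, ¬ IsNoise r B.offset i →
        response G i (Function.update (q i (x i)) m 0) =
          ∑ j ∈ Finset.univ.filter (fun j => IsNoise r B.offset j),
            β B.offset i j • response G j (q j (x j)))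

end

/-!
The lifted scheme is built from the coefficients of the one-shot schemes alone. Responses are tensor
products of columns of `G` with queries, so the decoding equations with coefficients `β c` cut out a
linear code `C c` in `F ^ N` (`decodingCode`), and the existence of a one-shot scheme makes the
projection of `C c` to any `T` coordinates surjective (`OneShotScheme.hasStrength`). Hence `C c`
contains the rows of a square matrix any `T` columns of which are independent
(`HasStrength.exists_matrix`).

For each message fix `N * K * n` seeds, `n = N ^ (M - 2)`, and a uniformly random automorphism `g`
of the vector space `F ^ Seed`. A query that involves message `m'` carries in its component at `m'` the
image, under `g` and a fixed linear map, of a vector of `F ^ Seed`. If `m'` is desired, this vector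
is a seed of its own. Otherwise it is a column of the matrix for `C c`, applied to the `N` seeds
that are reserved for the block and the set of messages which the interference belongs to; thus the
decoding equations hold. For both kinds of messages the vectors sent to any `T` servers are linearly
independent, and `g` acts transitively on independent families, so the queries to `T` servers have
the same law for every desired message (`map_liftQuery_restrict_eq`).

The difficulty is that the responses to the desired parts have to be linearly independent for
*every* value of `g`, and not just for most of them. The seeds are therefore mapped to vectors over
a finite extension `E` of `F`, and each seed is used `[E : F]` times, multiplied by the elements of
a basis of `E`. Independence for a given `g` is the
nonvanishing of a determinant, which is a nonzero polynomial because `G` is an MDS matrix; as there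
are finitely many `g`, all these polynomials are nonzero at some point over a large enough `E`
(`Seed.exists_linearMaps`).

That every interference term has its place, and the number of queries, follow from the combinatorics
of the symbolic matrix: every entry `k` lies in one block of level `k`, if `k < M`, and in one of
level `k - 1`, if `k ≥ 2` (`isBlockSystem_ofMessages`), and there are
`r ^ (M - k) * (N - r) ^ (k - 1)` entries `k` (`weight_ofMessages`).
-/

/-! ### Finite laws and entropy -/

theorem entropy_map_of_injOn {α β : Type} [Fintype α] [Fintype β] (p : PMF α) (f : α → β)
    (hf : Set.InjOn f p.support) : entropy (p.map f) = entropy p := by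
  classical
  have hmap : ∀ a ∈ p.support, (p.map f) (f a) = p a := by
    intro a ha
    rw [PMF.map_apply, tsum_eq_single a]
    · simp
    · intro a' ha'
      split_ifs with h
      · by_contra h0
        exact ha' (hf ((PMF.mem_support_iff _ _).2 h0) ha h.symm)
      · rfl
  unfold entropy
  rw [← Finset.sum_subset (Finset.subset_univ (Finset.univ.filter (· ∈ p.support))),
    ← Finset.sum_subset (Finset.subset_univ ((Finset.univ.filter (· ∈ p.support)).image f)),
    Finset.sum_image]
  · refine Finset.sum_congr rfl fun a ha => ?_
    rw [hmap a (by simpa using ha)]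
  · intro a ha a' ha' h
    exact hf (by simpa using ha) (by simpa using ha') h
  · intro b _ hb
    have : (p.map f) b = 0 := by
      rw [PMF.apply_eq_zero_iff, PMF.support_map]
      rintro ⟨a, ha, rfl⟩
      exact hb (Finset.mem_image_of_mem f (by simpa using ha))
    simp [this]
  · intro a _ ha
    have : p a = 0 := by
      rw [PMF.apply_eq_zero_iff]
      simpa using ha
    simp [this]

theorem condEntropy_eq_zero {α β : Type} [Fintype α] [Fintype β] (p : PMF (α × β))
    (h : Set.InjOn Prod.snd p.support) : condEntropy p = 0 := by
  rw [condEntropy, entropy_map_of_injOn p _ h, sub_self]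

theorem PMF.sum_toReal_eq_one {α : Type} [Fintype α] (p : PMF α) :
    ∑ a, (p a).toReal = 1 := by
  have h := p.tsum_coe
  rw [tsum_fintype] at h
  rw [← ENNReal.toReal_sum fun a _ => p.apply_ne_top a, h, ENNReal.toReal_one]

/-- Independent random variables have zero mutual information. -/
theorem mutualInfo_bind_map_eq_zero {α β : Type} [Fintype α] [Fintype β] (μ : PMF α) (ν : PMF β) :
    mutualInfo (ν.bind fun b => μ.map fun a => (a, b)) = 0 := by
  classical
  have hp : ∀ a b, (ν.bind fun b => μ.map fun a => (a, b)) (a, b) = μ a * ν b := by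
    intro a b
    rw [PMF.bind_apply, tsum_eq_single b]
    · rw [PMF.map_apply, tsum_eq_single a]
      · simp [mul_comm]
      · intro a' ha'
        simp [ha'.symm]
    · intro b' hb'
      rw [PMF.map_apply]
      simp [hb'.symm]
  have hfst : (ν.bind fun b => μ.map fun a => (a, b)).map Prod.fst = μ := by
    rw [PMF.map_bind]
    simp only [PMF.map_comp]
    have h2 : ∀ b : β, (PMF.map (Prod.fst ∘ fun a : α => (a, b)) μ) = μ := fun b => PMF.map_id μ
    simp only [h2, PMF.bind_const]
  have hsnd : (ν.bind fun b => μ.map fun a => (a, b)).map Prod.snd = ν := by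
    rw [PMF.map_bind]
    simp only [PMF.map_comp]
    have h2 : ∀ b : β, (PMF.map (Prod.snd ∘ fun a : α => (a, b)) μ) = PMF.pure b :=
      fun b => PMF.map_const μ b
    simp only [h2, PMF.bind_pure]
  rw [mutualInfo, hfst, hsnd]
  have : entropy (ν.bind fun b => μ.map fun a => (a, b)) = entropy μ + entropy ν := by
    unfold entropy
    rw [Fintype.sum_prod_type]
    simp only [hp, ENNReal.toReal_mul, Real.negMulLog_mul, Finset.sum_add_distrib]
    congr 1
    · simp only [← Finset.sum_mul, PMF.sum_toReal_eq_one, one_mul]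
    · simp only [← Finset.mul_sum, ← Finset.sum_mul, PMF.sum_toReal_eq_one, one_mul]
  rw [this, sub_self]

theorem PMF.map_uniformOfFintype_equiv {α β : Type} [Fintype α] [Nonempty α] [Fintype β]
    [Nonempty β] (e : α ≃ β) : (PMF.uniformOfFintype α).map e = PMF.uniformOfFintype β := by
  classical
  ext a
  rw [PMF.map_apply, tsum_eq_single (e.symm a)]
  · simp [Fintype.card_congr e]
  · intro b hb
    rw [if_neg]
    rintro rfl
    simp at hb

theorem PMF.map_uniformOfFintype_eq {α β : Type} [Fintype α] [Nonempty α] (e : α ≃ α)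
    {f f' : α → β} (h : ∀ a, f' a = f (e a)) :
    (PMF.uniformOfFintype α).map f = (PMF.uniformOfFintype α).map f' := by
  conv_lhs => rw [← PMF.map_uniformOfFintype_equiv e, PMF.map_comp]
  rw [funext h]
  rfl

/-! ### Linear algebra -/

/-- The general linear group acts transitively on linearly independent families of a given shape. -/
theorem exists_linearEquiv_apply_eq {F V ι : Type} [Field F] [AddCommGroup V] [Module F V]
    [FiniteDimensional F V] {v w : ι → V} (hv : LinearIndependent F v)
    (hw : LinearIndependent F w) : ∃ h : V ≃ₗ[F] V, ∀ i, h (v i) = w i := by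
  obtain ⟨P, hP⟩ := (Submodule.span F (Set.range v)).exists_isCompl
  obtain ⟨R, hR⟩ := (Submodule.span F (Set.range w)).exists_isCompl
  let e : Submodule.span F (Set.range v) ≃ₗ[F] Submodule.span F (Set.range w) :=
    (Module.Basis.span hv).equiv (Module.Basis.span hw) (Equiv.refl _)
  have hfin : Module.finrank F P = Module.finrank F R := by
    have h1 := Submodule.finrank_add_eq_of_isCompl hP
    have h2 := Submodule.finrank_add_eq_of_isCompl hR
    have h3 := e.finrank_eq
    omega
  let e' : P ≃ₗ[F] R := LinearEquiv.ofFinrankEq _ _ hfin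
  refine ⟨(Submodule.prodEquivOfIsCompl _ _ hP).symm.trans
    ((e.prodCongr e').trans (Submodule.prodEquivOfIsCompl _ _ hR)), fun i => ?_⟩
  have hvi : v i = (Module.Basis.span hv i : V) := by rw [Module.Basis.span_apply]
  have hwi : w i = (Module.Basis.span hw i : V) := by rw [Module.Basis.span_apply]
  have he : e (Module.Basis.span hv i) = Module.Basis.span hw i := by
    rw [Module.Basis.equiv_apply, Equiv.refl_apply]
  rw [LinearEquiv.trans_apply, hvi, Submodule.prodEquivOfIsCompl_symm_apply_left,
    LinearEquiv.trans_apply, LinearEquiv.prodCongr_apply, he, hwi,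
    Submodule.coe_prodEquivOfIsCompl']
  simp

/-! ### Vectors whose responses remain independent under all base changes -/

/-- The labels of the seed vectors of one message: a server, a position `x < K`, and a position
`b < n`, where `K * n` is the number of seed vectors per server. -/
abbrev Seed (N K n : ℕ) : Type := Fin N × Fin K × Fin n

theorem IsMDS.linearIndependent_comp {F : Type} [Field F] {N K : ℕ} {G : Matrix (Fin K) (Fin N) F}
    (hG : IsMDS G) {f : Fin K → Fin N} (hf : Function.Injective f) :
    LinearIndependent F (fun x k => G k (f x)) := by
  classical
  have h := hG (Finset.univ.image f) (by rw [Finset.card_image_of_injective _ hf]; simp)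
  exact h.comp (fun x => ⟨f x, Finset.mem_image_of_mem f (Finset.mem_univ x)⟩)
    fun x y hxy => hf (congrArg Subtype.val hxy)

namespace Seed

variable {F : Type} [Field F] {N K n : ℕ}

/-- The square matrix whose column `s` is the tensor product of the column of `G` at the server of
`s` with the vector `y · s` of length `N * n`. -/
def tensorMatrix (G : Matrix (Fin K) (Fin N) F) {R : Type} [CommRing R] [Algebra F R]
    (y : Matrix (Fin N × Fin n) (Seed N K n) R) : Matrix (Seed N K n) (Seed N K n) R :=
  Matrix.of fun s' s => algebraMap F R (G s'.2.1 s.1) * y (s'.1, s'.2.2) s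

theorem map_det_tensorMatrix (G : Matrix (Fin K) (Fin N) F) {R R' : Type} [CommRing R]
    [Algebra F R] [CommRing R'] [Algebra F R'] (f : R →ₐ[F] R')
    (y : Matrix (Fin N × Fin n) (Seed N K n) R) :
    f (tensorMatrix G y).det = (tensorMatrix G (y.map f)).det := by
  rw [AlgHom.map_det]
  congr 1
  ext s' s
  simp [tensorMatrix]

/-- Give each coordinate vector to `K` cyclically consecutive servers: since any `K` columns of `G`
form a basis, the tensor products are independent. -/
theorem exists_det_tensorMatrix_ne_zero [NeZero N] (hKN : K ≤ N) {G : Matrix (Fin K) (Fin N) F}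
    (hG : IsMDS G) :
    ∃ y : Matrix (Fin N × Fin n) (Seed N K n) F, (tensorMatrix G y).det ≠ 0 := by
  classical
  refine ⟨Matrix.of fun h s => if h = (s.1 - Fin.castLE hKN s.2.1, s.2.2) then 1 else 0, ?_⟩
  intro hdet
  obtain ⟨v, hv0, hv⟩ := Matrix.exists_mulVec_eq_zero_iff.2 hdet
  apply hv0
  have key : ∀ (a : Fin N) (b : Fin n) (x : Fin K), v (a + Fin.castLE hKN x, x, b) = 0 := by
    intro a b
    have hinj : Function.Injective fun x : Fin K => a + Fin.castLE hKN x := fun x y hxy =>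
      Fin.castLE_injective hKN (add_left_cancel hxy)
    refine Fintype.linearIndependent_iff.1 (hG.linearIndependent_comp hinj) _ ?_
    ext k
    have h := congrFun hv (a, k, b)
    simp only [Matrix.mulVec, dotProduct, tensorMatrix, Matrix.of_apply, Algebra.algebraMap_self,
      RingHom.id_apply, Fintype.sum_prod_type, Prod.mk.injEq, eq_sub_iff_add_eq, ite_and] at h
    rw [Finset.sum_comm] at h
    simpa [mul_comm] using h
  ext ⟨j, x, b⟩
  simpa using key (j - Fin.castLE hKN x) b x

/-- Over a suitable finite extension of `F` there is a point at which the finitely many nonzero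
polynomials `det (tensorMatrix G (y * γ))`, `γ` invertible over `F`, do not vanish. -/
theorem exists_extension_det_tensorMatrix_ne_zero [Fintype F] [NeZero N] (hKN : K ≤ N)
    {G : Matrix (Fin K) (Fin N) F} (hG : IsMDS G) :
    ∃ (E : Type) (_ : Field E) (_ : Algebra F E) (_ : FiniteDimensional F E)
      (y : Matrix (Fin N × Fin n) (Seed N K n) E),
      ∀ γ : Matrix (Seed N K n) (Seed N K n) F, IsUnit γ →
        (tensorMatrix G (y * γ.map (algebraMap F E))).det ≠ 0 := by
  classical
  let P := MvPolynomial ((Fin N × Fin n) × Seed N K n) F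
  let Y : Matrix (Fin N × Fin n) (Seed N K n) P := Matrix.of fun h s => MvPolynomial.X (h, s)
  -- A single polynomial takes care of all `γ`, because `F` is finite.
  let f : P := ∏ γ : (Matrix (Seed N K n) (Seed N K n) F)ˣ,
    (tensorMatrix G (Y * γ.1.map (algebraMap F P))).det
  have haeval : ∀ (R : Type) [CommRing R] [Algebra F R] (a : (Fin N × Fin n) × Seed N K n → R)
      (γ : Matrix (Seed N K n) (Seed N K n) F),
      MvPolynomial.aeval a (tensorMatrix G (Y * γ.map (algebraMap F P))).det =
        (tensorMatrix G ((Matrix.of fun h s => a (h, s)) * γ.map (algebraMap F R))).det := by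
    intro R _ _ a γ
    rw [map_det_tensorMatrix, Matrix.map_mul, Matrix.map_map]
    congr 3
    · ext h s
      simp [Y]
    · ext s s'
      exact (MvPolynomial.aeval a).commutes (γ s s')
  have hf : f ≠ 0 := by
    refine Finset.prod_ne_zero_iff.2 fun γ _ h0 => ?_
    obtain ⟨y, hy⟩ := exists_det_tensorMatrix_ne_zero (n := n) hKN hG
    have h := haeval F (fun p => (y * γ⁻¹.1) p.1 p.2) γ.1
    rw [h0, map_zero] at h
    apply hy
    rw [h]
    congr 2
    have : (Matrix.of fun h s => (y * γ⁻¹.1) h s) = y * γ⁻¹.1 := rfl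
    rw [this, Algebra.algebraMap_self]
    simp [Matrix.mul_assoc]
  have hex : ∃ a : (Fin N × Fin n) × Seed N K n → AlgebraicClosure F,
      MvPolynomial.aeval a f ≠ 0 := by
    by_contra! hcon
    apply hf
    apply MvPolynomial.map_injective (algebraMap F (AlgebraicClosure F))
      (algebraMap F (AlgebraicClosure F)).injective
    apply MvPolynomial.funext
    intro a
    rw [map_zero, map_zero, MvPolynomial.eval_map, ← MvPolynomial.aeval_def, hcon a]
  obtain ⟨a, ha⟩ := hex
  let E := IntermediateField.adjoin F (Set.range a)
  have hE : FiniteDimensional F E :=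
    IntermediateField.finiteDimensional_adjoin fun x _ => Algebra.IsIntegral.isIntegral x
  let a' : (Fin N × Fin n) × Seed N K n → E := fun p =>
    ⟨a p, IntermediateField.subset_adjoin F _ ⟨p, rfl⟩⟩
  have ha' : MvPolynomial.aeval a' f ≠ 0 := by
    intro h
    apply ha
    have := MvPolynomial.aeval_algebraMap_apply (AlgebraicClosure F) a' f
    rw [h, map_zero] at this
    exact this
  refine ⟨E, inferInstance, inferInstance, hE, Matrix.of fun h s => a' (h, s),
    fun γ hγ h0 => ha' ?_⟩
  rw [map_prod]
  refine Finset.prod_eq_zero (Finset.mem_univ hγ.unit) ?_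
  rw [haeval]
  exact h0

/-- There are `e` linear maps on `F ^ Seed` such that, for every basis of `F ^ Seed`, the tensor
products of the column of `G` at the server of a seed with the `e` images of the corresponding basis
vector are linearly independent. The maps are the products of one linear map into `E ^ (N * n)` with
the elements of a basis of the extension `E` of `F`. -/
theorem exists_linearMaps [Fintype F] [NeZero N] (hKN : K ≤ N)
    {G : Matrix (Fin K) (Fin N) F} (hG : IsMDS G) (n : ℕ) :
    ∃ e, 0 < e ∧ ∃ u : Fin e → (Seed N K n → F) →ₗ[F] (Fin (e * (N * n)) → F),
      ∀ g : (Seed N K n → F) ≃ₗ[F] (Seed N K n → F),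
        LinearIndependent F (fun (x : Fin e × Seed N K n) (k : Fin K) (l : Fin (e * (N * n))) =>
          G k x.2.1 * u x.1 (g (Pi.single x.2 1)) l) := by
  classical
  obtain ⟨E, _, _, _, y, hy⟩ := exists_extension_det_tensorMatrix_ne_zero (n := n) hKN hG
  let ε := Module.finBasis F E
  let κ : Fin (Module.finrank F E * (N * n)) ≃ Fin (Module.finrank F E) × (Fin N × Fin n) :=
    Fintype.equivOfCardEq (by simp)
  let y' (h : Fin N × Fin n) : (Seed N K n → F) →ₗ[F] E :=
    ∑ s, (LinearMap.toSpanSingleton F E (y h s)).comp (LinearMap.proj s)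
  refine ⟨Module.finrank F E, Module.finrank_pos,
    fun i => LinearMap.pi fun l => (ε.coord (κ l).1).comp
      ((LinearMap.mulLeft F (ε i)).comp (y' (κ l).2)), fun g => ?_⟩
  let γ : Matrix (Seed N K n) (Seed N K n) F := LinearMap.toMatrix' (g : (Seed N K n → F) →ₗ[F] _)
  have hγ : IsUnit γ := by
    refine IsUnit.of_mul_eq_one
      (LinearMap.toMatrix' (g.symm : (Seed N K n → F) →ₗ[F] (Seed N K n → F))) ?_
    rw [← LinearMap.toMatrix'_comp]
    simp
  have h1 := linearIndependent_smul ε.linearIndependent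
    (Matrix.linearIndependent_cols_of_det_ne_zero (hy γ hγ))
  let Φ : (Seed N K n → E) →ₗ[F] (Fin K → Fin (Module.finrank F E * (N * n)) → F) :=
    LinearMap.pi fun k => LinearMap.pi fun l =>
      (ε.coord (κ l).1).comp (LinearMap.proj ((κ l).2.1, k, (κ l).2.2))
  have hΦ : LinearMap.ker Φ = ⊥ := by
    rw [LinearMap.ker_eq_bot']
    intro t ht
    ext ⟨j, k, b⟩
    apply ε.repr.injective
    ext c
    have := congrFun (congrFun ht k) (κ.symm (c, (j, b)))
    simpa [Φ] using this
  have h3 : ∀ f : Fin (Module.finrank F E) × Seed N K n →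
      (Fin K → Fin (Module.finrank F E * (N * n)) → F),
      (Φ ∘ fun p => ε p.1 • (tensorMatrix G (y * γ.map (algebraMap F E))).col p.2) = f →
        LinearIndependent F f := by
    rintro _ rfl
    exact h1.map' Φ hΦ
  refine h3 _ ?_
  ext x k l
  have h2 : y' (κ l).2 (g (Pi.single x.2 1)) =
      ∑ s, y (κ l).2 s * algebraMap F E (γ s x.2) := by
    simp [y', γ, LinearMap.toMatrix'_apply, Algebra.smul_def, mul_comm]
  simp only [Φ, LinearMap.pi_apply, LinearMap.comp_apply, LinearMap.mulLeft_apply, h2,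
    LinearMap.proj_apply, Function.comp_apply, Pi.smul_apply, Matrix.col_apply, tensorMatrix,
    Matrix.of_apply, Matrix.mul_apply, Matrix.map_apply, smul_eq_mul, ← Algebra.smul_def,
    mul_smul_comm, map_smul]

end Seed

/-! ### Cyclic shifts of the columns -/

section Cyclic

variable {N : ℕ} [NeZero N]

theorem Fin.val_nsmul_one (s : ℕ) : (s • (1 : Fin N)).val = s % N := by
  induction s with
  | zero => simp
  | succ s ih => rw [succ_nsmul, Fin.val_add, ih, Fin.val_one', ← Nat.add_mod]

theorem Fin.val_nsmul_one_of_lt {s : ℕ} (h : s < N) : (s • (1 : Fin N)).val = s := by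
  rw [Fin.val_nsmul_one, Nat.mod_eq_of_lt h]

theorem Fin.val_nsmul_one_eq (a : Fin N) : a.val • (1 : Fin N) = a :=
  Fin.ext (Fin.val_nsmul_one_of_lt a.isLt)

theorem Fin.iterate_sub_one (s : ℕ) (c : Fin N) : (fun c => c - 1)^[s] c = c - s • 1 := by
  induction s with
  | zero => simp
  | succ s ih => rw [Function.iterate_succ_apply', ih, succ_nsmul, sub_sub]

theorem Fin.iterate_add_one (s : ℕ) (c : Fin N) : (fun c => c + 1)^[s] c = c + s • 1 := by
  induction s with
  | zero => simp
  | succ s ih => rw [Function.iterate_succ_apply', ih, succ_nsmul, add_assoc]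

theorem isNoise_sub_nsmul {r s : ℕ} {c j : Fin N} :
    IsNoise r (c - s • 1) j ↔ IsNoise r c (j + s • 1) := by
  rw [IsNoise, IsNoise, sub_sub_eq_add_sub]

/-- The columns `c, c - 1, …, c - r + 1` are the noise columns of offset `c - (r - 1)`. -/
theorem isNoise_sub_pred {r : ℕ} (hr : 1 ≤ r) (hrN : r ≤ N) {c j : Fin N} :
    IsNoise r (c - (r - 1) • 1) j ↔ (c - j).val < r := by
  have key : ∀ d : Fin N, d.val < r → ((r - 1) • 1 - d : Fin N).val < r := by
    intro d hd
    have h : ((r - 1) • 1 - d : Fin N) = (r - 1 - d.val) • 1 := by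
      rw [sub_eq_iff_eq_add]
      nth_rewrite 2 [← Fin.val_nsmul_one_eq d]
      rw [← add_nsmul]
      congr 1
      omega
    rw [h, Fin.val_nsmul_one_of_lt (by omega)]
    omega
  have h : j - (c - (r - 1) • 1) = (r - 1) • 1 - (c - j) := by abel
  rw [IsNoise, h]
  refine ⟨fun h' => ?_, key _⟩
  simpa using key _ h'

theorem card_filter_val_sub_lt {r : ℕ} (hrN : r ≤ N) (c : Fin N) :
    (Finset.univ.filter fun j : Fin N => (c - j).val < r).card = r := by
  have h : (Finset.univ.filter fun j : Fin N => (c - j).val < r).card =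
      (Finset.univ.filter fun j : Fin N => j.val < r).card := by
    refine Finset.card_bij' (fun j _ => c - j) (fun j _ => c - j) ?_ ?_ ?_ ?_ <;> simp
  rw [h, Fin.card_filter_val_lt, min_eq_right hrN]

end Cyclic

/-! ### Entries of the lifted matrix -/

theorem List.length_flatMap_range {α : Type} (f : ℕ → List α) {L : ℕ} (hf : ∀ s, (f s).length = L)
    (r : ℕ) : ((List.range r).flatMap f).length = r * L := by
  simp [List.length_flatMap, hf]

theorem List.getD_flatMap_range {α : Type} (f : ℕ → List α) {L : ℕ} (hf : ∀ s, (f s).length = L)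
    {r s i : ℕ} (hs : s < r) (hi : i < L) (d : α) :
    ((List.range r).flatMap f).getD (s * L + i) d = (f s).getD i d := by
  induction r with
  | zero => omega
  | succ r ih =>
    rw [List.range_succ, List.flatMap_append, List.flatMap_singleton]
    rcases Nat.lt_succ_iff_lt_or_eq.1 hs with h | rfl
    · rw [List.getD_append _ _ _ _ (by rw [List.length_flatMap_range f hf]; nlinarith), ih h]
    · rw [List.getD_append_right _ _ _ _ (by rw [List.length_flatMap_range f hf]; omega),
        List.length_flatMap_range f hf, Nat.add_sub_cancel_left]

namespace SymMatrix

variable {N : ℕ}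

theorem mem_positions {k : ℕ} {S : SymMatrix N} {b : ℕ × Fin N} :
    b ∈ positions k S ↔ b.1 < S.length ∧ S.entry b.1 b.2 = k := by
  obtain ⟨i, j⟩ := b
  simp [positions]

theorem nodup_positions (k : ℕ) (S : SymMatrix N) : (positions k S).Nodup := by
  rw [positions, List.nodup_flatMap]
  refine ⟨fun i _ => ?_, ?_⟩
  · exact ((List.nodup_finRange N).filter _).map fun a b h => congrArg Prod.snd h
  · refine List.nodup_range.imp fun {a b} hab => ?_
    intro x hx hx'
    simp only [List.mem_map] at hx hx'
    obtain ⟨_, _, rfl⟩ := hx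
    obtain ⟨_, _, h⟩ := hx'
    exact hab (congrArg Prod.fst h).symm

theorem entry_of_length_le {S : SymMatrix N} {i : ℕ} (hi : S.length ≤ i) (j : Fin N) :
    S.entry i j = 0 := by
  rw [entry, List.getD_eq_default _ _ hi]

variable [NeZero N]

theorem length_shift_iterate (S : SymMatrix N) (s : ℕ) : (shift^[s] S).length = S.length := by
  induction s with
  | zero => rfl
  | succ s ih => rw [Function.iterate_succ_apply', shift, List.length_map, ih]

theorem entry_shift_iterate (S : SymMatrix N) (s i : ℕ) (j : Fin N) :
    (shift^[s] S).entry i j = S.entry i (j + s • 1) := by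
  induction s generalizing j with
  | zero => simp
  | succ s ih =>
    rw [Function.iterate_succ_apply', succ_nsmul', ← add_assoc, ← ih]
    simp only [entry, shift, List.getD_eq_getElem?_getD, List.getElem?_map]
    cases (shift^[s] S)[i]? <;> rfl

theorem mem_columns {r l : ℕ} (hrN : r ≤ N) {b : ℕ × Fin N} {j : Fin N} :
    j ∈ columns r l b ↔ (b.2 - j).val < r := by
  have htau : ∀ s, ((tau l)^[s] b).2 = b.2 - s • 1 := by
    intro s
    induction s with
    | zero => simp
    | succ s ih => rw [Function.iterate_succ_apply', tau, ih, succ_nsmul, sub_sub]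
  simp only [columns, List.mem_map, List.mem_range, htau]
  constructor
  · rintro ⟨s, hs, rfl⟩
    rw [sub_sub_cancel, Fin.val_nsmul_one_of_lt (by omega)]
    exact hs
  · intro h
    exact ⟨_, h, by rw [Fin.val_nsmul_one_eq, sub_sub_cancel]⟩

theorem length_lift (r M : ℕ) (S : SymMatrix N) :
    (lift r M S).length = r * S.length + (positions M S).length := by
  rw [lift, List.length_append, List.length_map,
    List.length_flatMap_range _ (length_shift_iterate S)]

theorem entry_lift_copy {r M s i : ℕ} {S : SymMatrix N} (hs : s < r) (hi : i < S.length)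
    (j : Fin N) : (lift r M S).entry (s * S.length + i) j = S.entry i (j + s • 1) := by
  rw [← entry_shift_iterate, entry, lift, List.getD_append,
    List.getD_flatMap_range _ (length_shift_iterate S) hs hi]
  · rfl
  · rw [List.length_flatMap_range _ (length_shift_iterate S)]
    nlinarith

theorem entry_lift_new {r M a : ℕ} {S : SymMatrix N} (hrN : r ≤ N)
    (ha : a < (positions M S).length) (j : Fin N) :
    (lift r M S).entry (r * S.length + a) j =
      if ((positions M S)[a].2 - j).val < r then 0 else M + 1 := by
  rw [entry, lift, List.getD_append_right, List.length_flatMap_range _ (length_shift_iterate S),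
    Nat.add_sub_cancel_left, List.getD_eq_getElem _ _ (by simpa using ha), List.getElem_map]
  · simp only [mem_columns hrN]
  · rw [List.length_flatMap_range _ (length_shift_iterate S)]
    omega

theorem lift_row_cases {r M i : ℕ} {S : SymMatrix N} (hi : i < (lift r M S).length) :
    (∃ s < r, ∃ i' < S.length, i = s * S.length + i') ∨
      ∃ a < (positions M S).length, i = r * S.length + a := by
  rw [length_lift] at hi
  rcases lt_or_ge i (r * S.length) with h | h
  · have hpos : 0 < S.length := Nat.pos_of_ne_zero fun h0 => by simp [h0] at h
    refine Or.inl ⟨i / S.length, Nat.div_lt_of_lt_mul (by rwa [mul_comm]), i % S.length,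
      Nat.mod_lt _ hpos, ?_⟩
    rw [mul_comm, Nat.div_add_mod]
  · exact Or.inr ⟨i - r * S.length, by omega, by omega⟩

end SymMatrix

/-! ### The number of entries of each value -/

namespace SymMatrix

variable {N : ℕ}

/-- The sum of `w k` over all entries `k` of the matrix. -/
def weight (w : ℕ → ℕ) (S : SymMatrix N) : ℕ := (S.map fun row => ∑ j, w (row j)).sum

theorem weight_eq_sum (w : ℕ → ℕ) (S : SymMatrix N) :
    weight w S = ∑ i : Fin S.length, ∑ j, w (S.entry i j) := by
  rw [weight, ← Fin.sum_univ_fun_getElem]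
  refine Finset.sum_congr rfl fun i _ => Finset.sum_congr rfl fun j _ => ?_
  rw [entry, List.getD_eq_getElem _ _ i.isLt]

theorem weight_append (w : ℕ → ℕ) (S S' : SymMatrix N) :
    weight w (S ++ S') = weight w S + weight w S' := by
  simp [weight]

theorem length_positions (k : ℕ) (S : SymMatrix N) :
    (positions k S).length = weight (fun i => if i = k then 1 else 0) S := by
  rw [weight_eq_sum, positions, List.length_flatMap,
    ← Finset.sum_range (M := ℕ) fun i : ℕ => ∑ j : Fin N, if S.entry i j = k then (1 : ℕ) else 0,
    ← Multiset.sum_coe, ← Multiset.map_coe]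
  refine Finset.sum_congr (s₁ := Finset.range S.length) rfl fun i _ => ?_
  rw [List.length_map, ← Finset.sum_filter, Finset.sum_const, smul_eq_mul, mul_one]
  rfl

variable [NeZero N]

theorem weight_shift_iterate (w : ℕ → ℕ) (S : SymMatrix N) (s : ℕ) :
    weight w (shift^[s] S) = weight w S := by
  induction s with
  | zero => rfl
  | succ s ih =>
    rw [Function.iterate_succ_apply', ← ih, weight, shift, List.map_map, weight]
    congr 2
    ext row
    exact Equiv.sum_comp (Equiv.addRight (1 : Fin N)) fun j => w (row j)

theorem weight_flatMap_shift (w : ℕ → ℕ) (S : SymMatrix N) (r : ℕ) :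
    weight w ((List.range r).flatMap fun s => shift^[s] S) = r * weight w S := by
  induction r with
  | zero => simp [weight]
  | succ r ih =>
    rw [List.range_succ, List.flatMap_append, List.flatMap_singleton, weight_append, ih,
      weight_shift_iterate, Nat.succ_mul]

theorem weight_lift {r M : ℕ} (hrN : r ≤ N) {w : ℕ → ℕ} (hw : w 0 = 0) (S : SymMatrix N) :
    weight w (lift r M S) =
      r * weight w S + weight (fun i => if i = M then 1 else 0) S * ((N - r) * w (M + 1)) := by
  rw [lift, weight_append, weight_flatMap_shift, ← length_positions]
  congr 1
  rw [weight, List.map_map]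
  rw [List.sum_eq_card_nsmul _ ((N - r) * w (M + 1)), List.length_map, smul_eq_mul]
  intro x hx
  obtain ⟨b, _, rfl⟩ := List.mem_map.1 hx
  have h := Finset.card_filter_add_card_filter_not (s := Finset.univ)
    (fun j : Fin N => (b.2 - j).val < r)
  rw [card_filter_val_sub_lt hrN, Finset.card_univ, Fintype.card_fin] at h
  simp only [Function.comp_apply, mem_columns hrN, apply_ite w, hw, Finset.sum_ite,
    Finset.sum_const_zero, zero_add, Finset.sum_const, smul_eq_mul]
  congr 1
  omega

theorem weight_iterLift {r : ℕ} (hrN : r ≤ N) {w : ℕ → ℕ} (hw : w 0 = 0) (t : ℕ) :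
    weight w (iterLift N r t) =
      ∑ k ∈ Finset.range (t + 2), r ^ (t + 1 - k) * (N - r) ^ k * w (k + 1) := by
  induction t generalizing w with
  | zero =>
    have h := Finset.card_filter_add_card_filter_not (s := Finset.univ)
      (fun j : Fin N => j.val < r)
    rw [Fin.card_filter_val_lt, min_eq_right hrN, Finset.card_univ, Fintype.card_fin] at h
    have h' : (Finset.univ.filter fun j : Fin N => ¬ j.val < r).card = N - r := by omega
    rw [iterLift, base, weight, List.map_singleton, List.sum_singleton]
    simp only [apply_ite w, Finset.sum_ite, Finset.sum_const, smul_eq_mul, h',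
      Fin.card_filter_val_lt, min_eq_right hrN]
    simp [Finset.sum_range_succ]
  | succ t ih =>
    have h1 : (∑ k ∈ Finset.range (t + 2),
        r ^ (t + 1 - k) * (N - r) ^ k * if k + 1 = t + 2 then 1 else 0) = (N - r) ^ (t + 1) := by
      rw [Finset.sum_eq_single_of_mem (t + 1) (by simp)]
      · simp
      · intro k _ hk
        rw [if_neg (by omega), mul_zero]
    rw [iterLift, weight_lift hrN hw, ih hw, ih (by simp), h1, Finset.sum_range_succ _ (t + 2)]
    rw [Finset.mul_sum]
    congr 1
    · refine Finset.sum_congr rfl fun k hk => ?_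
      rw [Finset.mem_range] at hk
      rw [show t + 1 + 1 - k = t + 1 - k + 1 by omega, pow_succ]
      ring
    · simp [pow_succ, mul_assoc]

end SymMatrix

/-! ### The blocks of the lifted matrix -/

/-- The blocks `𝓑` cover the matrix `S`, whose entries are at most `M`: for every `1 ≤ k < M`, each
entry with value `k` or `k + 1` lies in exactly one block of level `k`. -/
structure IsBlockSystem {N : ℕ} [NeZero N] (r M : ℕ) (S : SymMatrix N) (𝓑 : List (Block N)) :
    Prop where
  row_lt : ∀ B ∈ 𝓑, ∀ j, B.row j < S.length
  entry_row : ∀ B ∈ 𝓑, ∀ j,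
    S.entry (B.row j) j = if IsNoise r B.offset j then B.level else B.level + 1
  one_le_level : ∀ B ∈ 𝓑, 1 ≤ B.level
  level_lt : ∀ B ∈ 𝓑, B.level < M
  entry_le : ∀ i j, S.entry i j ≤ M
  exists_block : ∀ j, ∀ i < S.length, ∀ k, 1 ≤ k → k < M → S.entry i j = k ∨ S.entry i j = k + 1 →
    ∃ B ∈ 𝓑, B.level = k ∧ B.row j = i
  eq_of_row : ∀ B ∈ 𝓑, ∀ B' ∈ 𝓑, ∀ j, B.level = B'.level → B.row j = B'.row j → B = B'

theorem Nat.eq_and_eq_of_mul_add_eq {L s s' i i' : ℕ} (hi : i < L) (hi' : i' < L)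
    (h : s * L + i = s' * L + i') : s = s' ∧ i = i' := by
  have hL : 0 < L := by omega
  have h1 := congrArg (· / L) h
  have h2 := congrArg (· % L) h
  simp only [mul_comm _ L, Nat.mul_add_div hL, Nat.div_eq_of_lt hi, Nat.div_eq_of_lt hi',
    add_zero, Nat.mul_add_mod, Nat.mod_eq_of_lt hi, Nat.mod_eq_of_lt hi'] at h1 h2
  exact ⟨h1, h2⟩

namespace Block

variable {N : ℕ} [NeZero N]

theorem copy_row (S : SymMatrix N) (s : ℕ) (B : Block N) (j : Fin N) :
    (copy S s B).row j = s * S.length + B.row (j + s • 1) := by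
  rw [← Fin.iterate_add_one]
  rfl

theorem isNoise_copy_offset {S : SymMatrix N} {r s : ℕ} {B : Block N} {j : Fin N} :
    IsNoise r (copy S s B).offset j ↔ IsNoise r B.offset (j + s • 1) := by
  rw [copy, Fin.iterate_sub_one, isNoise_sub_nsmul]

theorem isNoise_new_offset {S : SymMatrix N} {r M a : ℕ} (hr : 1 ≤ r) (hrN : r ≤ N)
    {b : ℕ × Fin N} {j : Fin N} :
    IsNoise r (new S r M a b).offset j ↔ (b.2 - j).val < r := by
  rw [new, Fin.iterate_sub_one, isNoise_sub_pred hr hrN]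

end Block

theorem isBlockSystem_base {N r : ℕ} [NeZero N] :
    IsBlockSystem r 2 (SymMatrix.iterLift N r 0) (Block.iterLift N r 0) := by
  have hentry : ∀ j, (SymMatrix.iterLift N r 0).entry 0 j = if j.val < r then 1 else 2 :=
    fun j => rfl
  constructor
  · simp [Block.iterLift, SymMatrix.iterLift, SymMatrix.base]
  · intro B hB j
    rw [Block.iterLift, List.mem_singleton] at hB
    subst hB
    rw [hentry]
    simp [IsNoise]
  · simp [Block.iterLift]
  · simp [Block.iterLift]
  · intro i j
    rcases Nat.eq_zero_or_pos i with rfl | hi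
    · rw [hentry]
      split_ifs <;> omega
    · rw [SymMatrix.entry_of_length_le hi]
      omega
  · intro j i hi k hk hk' _
    refine ⟨_, List.mem_singleton_self _, by simp; omega, ?_⟩
    simp [SymMatrix.iterLift, SymMatrix.base] at hi
    simp [hi]
  · intro B hB B' hB' _ _ _
    rw [Block.iterLift, List.mem_singleton] at hB hB'
    rw [hB, hB']

open SymMatrix in
theorem IsBlockSystem.lift {N r M : ℕ} [NeZero N] (hr : 1 ≤ r) (hrN : r ≤ N) (hM : 1 ≤ M)
    {S : SymMatrix N} {𝓑 : List (Block N)} (h : IsBlockSystem r M S 𝓑) :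
    IsBlockSystem r (M + 1) (SymMatrix.lift r M S)
      (((List.range r).flatMap fun s => 𝓑.map (Block.copy S s)) ++
        (positions M S).mapIdx (Block.new S r M)) := by
  have hmem : ∀ {B}, B ∈ ((List.range r).flatMap fun s => 𝓑.map (Block.copy S s)) ++
        (positions M S).mapIdx (Block.new S r M) ↔
      (∃ s < r, ∃ B' ∈ 𝓑, Block.copy S s B' = B) ∨
        ∃ a, ∃ ha : a < (positions M S).length, Block.new S r M a (positions M S)[a] = B := by
    intro B
    simp [List.mem_mapIdx]
  have hpos : ∀ {a} (ha : a < (positions M S).length),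
      (positions M S)[a].1 < S.length ∧ S.entry (positions M S)[a].1 (positions M S)[a].2 = M :=
    fun ha => mem_positions.1 (List.getElem_mem ha)
  have hnewrow : ∀ a (b : ℕ × Fin N) j, (Block.new S r M a b).row j =
      if (b.2 - j).val < r then (b.2 - j).val * S.length + b.1 else r * S.length + a :=
    fun a b j => rfl
  have hlt : ∀ {s i}, s < r → i < S.length → s * S.length + i < r * S.length := by
    intro s i hs hi
    nlinarith
  constructor
  · intro B hB j
    rw [length_lift]
    rcases hmem.1 hB with ⟨s, hs, B', hB', rfl⟩ | ⟨a, ha, rfl⟩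
    · rw [Block.copy_row]
      have := hlt hs (h.row_lt B' hB' (j + s • 1))
      omega
    · rw [hnewrow]
      split_ifs with hj
      · have := hlt hj (hpos ha).1
        omega
      · omega
  · intro B hB j
    rcases hmem.1 hB with ⟨s, hs, B', hB', rfl⟩ | ⟨a, ha, rfl⟩
    · rw [Block.copy_row, entry_lift_copy hs (h.row_lt B' hB' _), h.entry_row B' hB']
      simp only [Block.isNoise_copy_offset]
      rfl
    · simp only [Block.isNoise_new_offset hr hrN, hnewrow]
      split_ifs with hj
      · rw [entry_lift_copy hj (hpos ha).1, Fin.val_nsmul_one_eq, add_sub_cancel, (hpos ha).2]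
        rfl
      · rw [entry_lift_new hrN ha, if_neg hj]
        rfl
  · intro B hB
    rcases hmem.1 hB with ⟨s, hs, B', hB', rfl⟩ | ⟨a, ha, rfl⟩
    · exact h.one_le_level B' hB'
    · exact hM
  · intro B hB
    rcases hmem.1 hB with ⟨s, hs, B', hB', rfl⟩ | ⟨a, ha, rfl⟩
    · exact (h.level_lt B' hB').trans (Nat.lt_succ_self M)
    · exact Nat.lt_succ_self M
  · intro i j
    rcases lt_or_ge i (SymMatrix.lift r M S).length with hi | hi
    · rcases lift_row_cases hi with ⟨s, hs, i', hi', rfl⟩ | ⟨a, ha, rfl⟩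
      · rw [entry_lift_copy hs hi']
        exact (h.entry_le _ _).trans (Nat.le_succ M)
      · rw [entry_lift_new hrN ha]
        split_ifs <;> omega
    · rw [entry_of_length_le hi]
      omega
  · intro j i hi k hk hkM hik
    rcases lift_row_cases hi with ⟨s, hs, i', hi', rfl⟩ | ⟨a, ha, rfl⟩
    · rw [entry_lift_copy hs hi'] at hik
      rcases Nat.lt_succ_iff_lt_or_eq.1 hkM with hkM' | rfl
      · obtain ⟨B, hB, hBk, hBi⟩ := h.exists_block (j + s • 1) i' hi' k hk hkM' hik
        exact ⟨_, hmem.2 (Or.inl ⟨s, hs, B, hB, rfl⟩), hBk, by rw [Block.copy_row, hBi]⟩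
      · have hik' : S.entry i' (j + s • 1) = k := by
          have := h.entry_le i' (j + s • 1)
          omega
        obtain ⟨a, ha, hab⟩ := List.mem_iff_getElem.1
          (mem_positions.2 (⟨hi', hik'⟩ : (i', j + s • (1 : Fin N)).1 < S.length ∧ _))
        refine ⟨_, hmem.2 (Or.inr ⟨a, ha, rfl⟩), rfl, ?_⟩
        rw [hnewrow, hab, add_sub_cancel_left, Fin.val_nsmul_one_of_lt (by omega), if_pos hs]
    · rw [entry_lift_new hrN ha] at hik
      by_cases hj : ((positions M S)[a].2 - j).val < r
      · rw [if_pos hj] at hik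
        omega
      · rw [if_neg hj] at hik
        refine ⟨_, hmem.2 (Or.inr ⟨a, ha, rfl⟩), ?_, ?_⟩
        · change M = k
          omega
        · rw [hnewrow, if_neg hj]
  · intro B hB B' hB' j hlev hrow
    rcases hmem.1 hB with ⟨s, hs, B, hB1, rfl⟩ | ⟨a, ha, rfl⟩ <;>
      rcases hmem.1 hB' with ⟨s', hs', B', hB1', rfl⟩ | ⟨a', ha', rfl⟩
    · rw [Block.copy_row, Block.copy_row] at hrow
      obtain ⟨rfl, hrow⟩ := Nat.eq_and_eq_of_mul_add_eq (h.row_lt B hB1 _) (h.row_lt B' hB1' _) hrow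
      rw [h.eq_of_row B hB1 B' hB1' _ hlev hrow]
    · exact absurd hlev (h.level_lt B hB1).ne
    · exact absurd hlev.symm (h.level_lt B' hB1').ne
    · have haa : a = a' := by
        rw [hnewrow, hnewrow] at hrow
        split_ifs at hrow with h1 h2 h2
        · obtain ⟨hs, hi⟩ := Nat.eq_and_eq_of_mul_add_eq (hpos ha).1 (hpos ha').1 hrow
          exact (nodup_positions M S).getElem_inj_iff.1
            (Prod.ext hi (sub_left_injective (Fin.ext hs)))
        · have := hlt h1 (hpos ha).1
          omega
        · have := hlt h2 (hpos ha').1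
          omega
        · omega
      subst haa
      rfl

theorem isBlockSystem_ofMessages {N r M : ℕ} [NeZero N] (hr : 1 ≤ r) (hrN : r ≤ N) (hM : 2 ≤ M) :
    IsBlockSystem r M (SymMatrix.ofMessages N r M) (Block.ofMessages N r M) := by
  obtain ⟨t, rfl⟩ := Nat.exists_eq_add_of_le' hM
  change IsBlockSystem r (t + 2) (SymMatrix.iterLift N r t) (Block.iterLift N r t)
  clear hM
  induction t with
  | zero => exact isBlockSystem_base
  | succ t ih => exact ih.lift hr hrN (by omega)

theorem weight_ofMessages {N r M : ℕ} [NeZero N] (hrN : r ≤ N) (hM : 2 ≤ M) {w : ℕ → ℕ}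
    (hw : w 0 = 0) :
    (SymMatrix.ofMessages N r M).weight w =
      ∑ k ∈ Finset.range M, r ^ (M - 1 - k) * (N - r) ^ k * w (k + 1) := by
  obtain ⟨t, rfl⟩ := Nat.exists_eq_add_of_le' hM
  exact SymMatrix.weight_iterLift hrN hw t

/-! ### Labelling the queries of a symbolic matrix -/

theorem Finset.exists_injOn_fin {α : Type} (s : Finset α) {n : ℕ} (hn : 0 < n) (h : s.card ≤ n) :
    ∃ f : α → Fin n, Set.InjOn f s := by
  classical
  refine ⟨fun a => if ha : a ∈ s then Fin.castLE h (s.equivFin ⟨a, ha⟩) else ⟨0, hn⟩, ?_⟩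
  intro a ha b hb hab
  have ha' : a ∈ s := ha
  have hb' : b ∈ s := hb
  simpa [ha', hb'] using hab

theorem card_filter_mem_card_eq_succ {M : ℕ} (m : Fin M) (k : ℕ) :
    (Finset.univ.filter fun I : Finset (Fin M) => m ∈ I ∧ I.card = k + 1).card =
      (M - 1).choose k := by
  have h : (Finset.powersetCard k (Finset.univ.erase m)).card = (M - 1).choose k := by
    rw [Finset.card_powersetCard, Finset.card_erase_of_mem (Finset.mem_univ m), Finset.card_univ,
      Fintype.card_fin]
  rw [← h]
  refine Finset.card_bij' (fun I _ => I.erase m) (fun I _ => insert m I) ?_ ?_ ?_ ?_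
  · intro I hI
    simp only [Finset.mem_filter, Finset.mem_univ, true_and] at hI
    rw [Finset.mem_powersetCard]
    exact ⟨Finset.erase_subset_erase m (Finset.subset_univ I),
      by rw [Finset.card_erase_of_mem hI.1, hI.2, Nat.add_sub_cancel]⟩
  · intro I hI
    rw [Finset.mem_powersetCard] at hI
    have hm : m ∉ I := fun h => Finset.notMem_erase m _ (hI.1 h)
    simp [Finset.card_insert_of_notMem hm, hI.2]
  · intro I hI
    simp only [Finset.mem_filter, Finset.mem_univ, true_and] at hI
    exact Finset.insert_erase hI.1
  · intro I hI
    rw [Finset.mem_powersetCard] at hI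
    have hm : m ∉ I := fun h => Finset.notMem_erase m _ (hI.1 h)
    exact Finset.erase_insert hm

namespace SymMatrix

variable {N : ℕ}

/-- The queries to server `j` which involve message `m`, in one repetition of `S`: pairs of a row
and a set of messages. -/
def slotsWith (S : SymMatrix N) {M : ℕ} (m : Fin M) (j : Fin N) : Finset (ℕ × Finset (Fin M)) :=
  (Finset.range S.length ×ˢ Finset.univ).filter fun y => m ∈ y.2 ∧ y.2.card = S.entry y.1 j

theorem mem_slotsWith {S : SymMatrix N} {M : ℕ} {m : Fin M} {j : Fin N}
    {y : ℕ × Finset (Fin M)} :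
    y ∈ S.slotsWith m j ↔ y.1 < S.length ∧ m ∈ y.2 ∧ y.2.card = S.entry y.1 j := by
  simp [slotsWith]

theorem sum_card_slotsWith [NeZero N] {r M : ℕ} (hrN : r ≤ N) (hM : 2 ≤ M) (m : Fin M) :
    ∑ j, ((ofMessages N r M).slotsWith m j).card = N ^ (M - 1) := by
  have h := weight_ofMessages (N := N) (r := r) hrN hM
    (w := fun k => (Finset.univ.filter fun I : Finset (Fin M) => m ∈ I ∧ I.card = k).card) (by
      rw [Finset.card_eq_zero, Finset.filter_eq_empty_iff]
      rintro I - ⟨hm, h0⟩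
      rw [Finset.card_eq_zero] at h0
      simp [h0] at hm)
  simp only [card_filter_mem_card_eq_succ] at h
  have hbin := add_pow (N - r) r (M - 1)
  rw [Nat.sub_add_cancel hrN, Nat.sub_add_cancel (by omega : 1 ≤ M)] at hbin
  have hswap : N ^ (M - 1) = ∑ k ∈ Finset.range M,
      r ^ (M - 1 - k) * (N - r) ^ k * (M - 1).choose k := by
    rw [hbin]
    refine Finset.sum_congr rfl fun k _ => ?_
    rw [mul_comm (r ^ _), Nat.cast_id]
  rw [hswap, ← h, weight_eq_sum, Finset.sum_comm]
  refine Finset.sum_congr rfl fun j _ => ?_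
  rw [slotsWith, Finset.card_filter, Finset.sum_product, Finset.sum_range]
  refine Finset.sum_congr rfl fun i _ => ?_
  rw [Finset.card_filter]

end SymMatrix

section Labels

variable {N r M : ℕ} [NeZero N] {S : SymMatrix N} {𝓑 : List (Block N)}

/-- The query to server `j` in which the interference for the set `I` and the block `B` occurs,
when message `m` is desired. -/
def Block.slot (r : ℕ) (m : Fin M) (j : Fin N) (p : Block N × Finset (Fin M)) :
    ℕ × Finset (Fin M) :=
  (p.1.row j, if IsNoise r p.1.offset j then p.2 else insert m p.2)

/-- The pairs of a block `B` and a set `I` of messages whose interference involves message `m'`,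
when message `m` is desired. -/
def blockPairs (𝓑 : List (Block N)) (m m' : Fin M) : Set (Block N × Finset (Fin M)) :=
  {p | p.1 ∈ 𝓑 ∧ m ∉ p.2 ∧ m' ∈ p.2 ∧ p.2.card = p.1.level}

/-- For an undesired message `m'`, the interference terms correspond bijectively to the queries to
server `j` that involve `m'`. -/
theorem IsBlockSystem.bijOn_slot (h : IsBlockSystem r M S 𝓑) {m m' : Fin M} (hm : m' ≠ m)
    (j : Fin N) :
    Set.BijOn (Block.slot r m j) (blockPairs 𝓑 m m') (S.slotsWith m' j) := by
  refine ⟨?_, ?_, ?_⟩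
  · rintro ⟨B, I⟩ ⟨hB, hmI, hm'I, hI⟩
    rw [Finset.mem_coe, SymMatrix.mem_slotsWith]
    refine ⟨h.row_lt B hB j, ?_, ?_⟩
    · simp only [Block.slot]
      split_ifs
      · exact hm'I
      · exact Finset.mem_insert_of_mem hm'I
    · simp only [Block.slot, h.entry_row B hB]
      split_ifs
      · exact hI
      · rw [Finset.card_insert_of_notMem hmI, hI]
  · rintro ⟨B, I⟩ ⟨hB, hmI, hm'I, hI⟩ ⟨B', I'⟩ ⟨hB', hmI', hm'I', hI'⟩ heq
    simp only [Block.slot, Prod.mk.injEq] at heq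
    have hII : I = I' := by
      have := congrArg (fun J => Finset.erase J m) heq.2
      simp only [apply_ite (fun J => Finset.erase J m), Finset.erase_insert hmI,
        Finset.erase_insert hmI', Finset.erase_eq_of_notMem hmI,
        Finset.erase_eq_of_notMem hmI', ite_self] at this
      exact this
    subst hII
    rw [h.eq_of_row B hB B' hB' j (hI.symm.trans hI') heq.1]
  · rintro ⟨i, J⟩ hy
    rw [Finset.mem_coe, SymMatrix.mem_slotsWith] at hy
    obtain ⟨hi, hm'J, hJ⟩ := hy
    have hm'I : m' ∈ J.erase m := Finset.mem_erase.2 ⟨hm, hm'J⟩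
    have hk : 1 ≤ (J.erase m).card := Finset.card_pos.2 ⟨m', hm'I⟩
    have hkM : (J.erase m).card < M := by
      have := Finset.card_lt_univ_of_notMem (Finset.notMem_erase m J)
      rwa [Fintype.card_fin] at this
    have hentry : (m ∉ J ∧ S.entry i j = (J.erase m).card) ∨
        (m ∈ J ∧ S.entry i j = (J.erase m).card + 1) := by
      by_cases hmJ : m ∈ J
      · exact Or.inr ⟨hmJ, by rw [Finset.card_erase_add_one hmJ, ← hJ]⟩
      · exact Or.inl ⟨hmJ, by rw [Finset.erase_eq_of_notMem hmJ, ← hJ]⟩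
    obtain ⟨B, hB, hBk, hBi⟩ := h.exists_block j i hi _ hk hkM (hentry.imp And.right And.right)
    refine ⟨(B, J.erase m), ⟨hB, Finset.notMem_erase m J, hm'I, hBk.symm⟩, ?_⟩
    have hrow := h.entry_row B hB j
    rw [hBi, hBk] at hrow
    simp only [Block.slot, hBi, Prod.mk.injEq, true_and]
    split_ifs at hrow ⊢
    · exact Finset.erase_eq_of_notMem (by rcases hentry with h | h; exacts [h.1, by omega])
    · exact Finset.insert_erase (by rcases hentry with h | h; exacts [by omega, h.1])

theorem IsBlockSystem.finite_blockPairs (h : IsBlockSystem r M S 𝓑) {m m' : Fin M}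
    (hm : m' ≠ m) : (blockPairs 𝓑 m m').Finite :=
  Set.Finite.of_finite_image ((h.bijOn_slot hm 0).image_eq ▸ Finset.finite_toSet _)
    (h.bijOn_slot hm 0).injOn

theorem IsBlockSystem.ncard_blockPairs (h : IsBlockSystem r M S 𝓑) {m m' : Fin M}
    (hm : m' ≠ m) (j : Fin N) : (blockPairs 𝓑 m m').ncard = (S.slotsWith m' j).card := by
  rw [← Set.ncard_coe_finset, ← (h.bijOn_slot hm j).image_eq,
    (h.bijOn_slot hm j).injOn.ncard_image]

theorem card_slotsWith_ofMessages (hr : 1 ≤ r) (hrN : r ≤ N) (hM : 2 ≤ M) (m : Fin M)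
    (j : Fin N) : ((SymMatrix.ofMessages N r M).slotsWith m j).card = N ^ (M - 2) := by
  have h := isBlockSystem_ofMessages hr hrN hM
  have : Nontrivial (Fin M) := Fin.nontrivial_iff_two_le.2 hM
  obtain ⟨m₁, hm₁⟩ := exists_ne m
  have hsum := SymMatrix.sum_card_slotsWith hrN hM m
  rw [Finset.sum_congr rfl fun j' _ => (h.ncard_blockPairs hm₁.symm j').symm, Finset.sum_const,
    Finset.card_univ, Fintype.card_fin, h.ncard_blockPairs hm₁.symm j, smul_eq_mul,
    show M - 1 = M - 2 + 1 by omega, pow_succ'] at hsum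
  exact Nat.eq_of_mul_eq_mul_left (NeZero.pos N) hsum

/-- The queries to each server that involve an undesired message `m'` can be labelled in such a way
that the label of a query depends only on the block and on the set of messages which its
interference belongs to. -/
theorem exists_labels_interference (hr : 1 ≤ r) (hrN : r ≤ N) (hM : 2 ≤ M) {m m' : Fin M}
    (hm : m' ≠ m) :
    ∃ (ψ : Fin N → ℕ × Finset (Fin M) → Fin (N ^ (M - 2))) (c : Fin (N ^ (M - 2)) → Fin N),
      (∀ j, Set.InjOn (ψ j) ((SymMatrix.ofMessages N r M).slotsWith m' j)) ∧
      ∀ p ∈ blockPairs (Block.ofMessages N r M) m m', ∃ b, c b = p.1.offset ∧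
        ∀ j, ψ j (Block.slot r m j p) = b := by
  have h := isBlockSystem_ofMessages hr hrN hM
  have : Inhabited (Block N) := ⟨⟨0, 0, fun _ => 0⟩⟩
  have hfin := h.finite_blockPairs hm
  have hcard := (h.ncard_blockPairs hm 0).trans (card_slotsWith_ofMessages hr hrN hM m' 0)
  rw [Set.ncard_eq_toFinset_card _ hfin] at hcard
  obtain ⟨θ, hθ⟩ := hfin.toFinset.exists_injOn_fin (pow_pos (NeZero.pos N) _) hcard.le
  rw [hfin.coe_toFinset] at hθ
  refine ⟨fun j y => θ (Function.invFunOn (Block.slot r m j)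
      (blockPairs (Block.ofMessages N r M) m m') y),
    fun b => (Function.invFunOn θ (blockPairs (Block.ofMessages N r M) m m') b).1.offset,
    fun j => ?_, fun p hp => ⟨θ p, ?_, fun j => ?_⟩⟩
  · have hs := (h.bijOn_slot hm j).surjOn
    exact hθ.comp (Function.invFunOn_injOn_image _ _ |>.mono hs)
      fun y hy => Function.invFunOn_mem (hs hy)
  · exact congrArg (fun p => p.1.offset) (hθ.leftInvOn_invFunOn hp)
  · exact congrArg θ ((h.bijOn_slot hm j).injOn.leftInvOn_invFunOn hp)

theorem exists_labels_desired (hr : 1 ≤ r) (hrN : r ≤ N) (hM : 2 ≤ M) (m : Fin M) :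
    ∃ φ : Fin N → ℕ × Finset (Fin M) → Fin (N ^ (M - 2)),
      ∀ j, Set.InjOn (φ j) ((SymMatrix.ofMessages N r M).slotsWith m j) := by
  choose φ hφ using fun j => ((SymMatrix.ofMessages N r M).slotsWith m j).exists_injOn_fin
    (pow_pos (NeZero.pos N) _) (card_slotsWith_ofMessages hr hrN hM m j).le
  exact ⟨φ, hφ⟩

end Labels

/-! ### Responses as tensors -/

section Response

variable {F : Type} [Field F] {N K M ℓ : ℕ} (G : Matrix (Fin K) (Fin N) F)

theorem response_single (i : Fin N) (q : Query F M ℓ) (m : Fin M) (k : Fin K) (l : Fin ℓ) :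
    response G i q (Pi.single m (Pi.single k (Pi.single l 1))) = G k i * q m l := by
  simp only [response, LinearMap.coe_mk, AddHom.coe_mk, stored]
  rw [Fintype.sum_eq_single m, Fintype.sum_eq_single l, Fintype.sum_eq_single k]
  · simp
  · intro k' hk'
    simp [hk']
  · intro l' hl'
    rw [Finset.sum_eq_zero, zero_mul]
    intro k' _
    rcases eq_or_ne k' k with rfl | hk' <;> simp [*]
  · intro m' hm'
    simp [hm']

/-- The linear form on the databases whose coefficients at message `m` are `t`. -/
def tensorForm (m : Fin M) :
    (Fin K → Fin ℓ → F) →ₗ[F] (Database F M K ℓ →ₗ[F] F) where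
  toFun t :=
    { toFun := fun W => ∑ l, ∑ k, t k l * W m k l
      map_add' := fun W W' => by simp [mul_add, Finset.sum_add_distrib]
      map_smul' := fun a W => by simp [Finset.mul_sum, mul_left_comm] }
  map_add' t t' := LinearMap.ext fun W => by simp [add_mul, Finset.sum_add_distrib]
  map_smul' a t := LinearMap.ext fun W => by simp [mul_assoc, Finset.mul_sum]

theorem tensorForm_apply (m : Fin M) (t : Fin K → Fin ℓ → F) (W : Database F M K ℓ) :
    tensorForm m t W = ∑ l, ∑ k, t k l * W m k l :=
  rfl

theorem response_apply (i : Fin N) (q : Query F M ℓ) (W : Database F M K ℓ) :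
    response G i q W = ∑ m, tensorForm m (fun k l => G k i * q m l) W := by
  simp only [response, LinearMap.coe_mk, AddHom.coe_mk, stored, tensorForm_apply, Finset.sum_mul]
  refine Finset.sum_congr rfl fun m _ => Finset.sum_congr rfl fun l _ =>
    Finset.sum_congr rfl fun k _ => by ring

theorem response_eq_sum_iff (i : Fin N) (q : Query F M ℓ) {J : Finset (Fin N)} (a : Fin N → F)
    (q' : Fin N → Query F M ℓ) :
    response G i q = ∑ j ∈ J, a j • response G j (q' j) ↔
      ∀ m k l, G k i * q m l = ∑ j ∈ J, a j * (G k j * q' j m l) := by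
  constructor
  · intro h m k l
    have := LinearMap.congr_fun h (Pi.single m (Pi.single k (Pi.single l 1)))
    simpa [response_single] using this
  · intro h
    refine LinearMap.ext fun W => ?_
    simp only [LinearMap.sum_apply, LinearMap.smul_apply, response_apply, smul_eq_mul, h,
      tensorForm_apply, Finset.mul_sum, Finset.sum_mul]
    symm
    rw [Finset.sum_comm]
    refine Finset.sum_congr rfl fun m _ => ?_
    rw [Finset.sum_comm]
    refine Finset.sum_congr rfl fun l _ => ?_
    rw [Finset.sum_comm]
    refine Finset.sum_congr rfl fun k _ => Finset.sum_congr rfl fun j _ => by ring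

theorem response_single_message (i : Fin N) (m : Fin M) (v : Fin ℓ → F) :
    response G i (Pi.single m v : Query F M ℓ) = tensorForm m fun k l => G k i * v l := by
  refine LinearMap.ext fun W => ?_
  rw [response_apply, Fintype.sum_eq_single m]
  · simp
  · intro m' hm'
    simp [hm', tensorForm_apply]

theorem tensorForm_injective (m : Fin M) :
    LinearMap.ker (tensorForm (F := F) (K := K) (ℓ := ℓ) m) = ⊥ := by
  rw [LinearMap.ker_eq_bot']
  intro t ht
  ext k l
  have h := LinearMap.congr_fun ht (Pi.single m (Pi.single k (Pi.single l 1)))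
  rw [tensorForm_apply, Fintype.sum_eq_single l, Fintype.sum_eq_single k] at h
  · simpa using h
  · intro k' hk'
    simp [hk']
  · intro l' hl'
    refine Finset.sum_eq_zero fun k' _ => ?_
    rcases eq_or_ne k' k with rfl | hk' <;> simp [*]

/-- The message `m` is determined by `K * ℓ` linearly independent forms in it. -/
theorem eq_zero_of_tensorForm_eq_zero {ι : Type} [Fintype ι] (m : Fin M)
    {t : ι → Fin K → Fin ℓ → F} (ht : LinearIndependent F t) (hcard : Fintype.card ι = K * ℓ)
    {W : Database F M K ℓ} (hW : ∀ i, tensorForm m (t i) W = 0) : W m = 0 := by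
  have hspan := ht.span_eq_top_of_card_eq_finrank' (by
    simp [hcard, Module.finrank_pi_fintype])
  have hker : (⊤ : Submodule F (Fin K → Fin ℓ → F)) ≤
      LinearMap.ker ((LinearMap.applyₗ W).comp (tensorForm (F := F) m)) := by
    rw [← hspan, Submodule.span_le]
    rintro _ ⟨i, rfl⟩
    exact hW i
  ext k l
  have h : tensorForm m (Pi.single k (Pi.single l 1)) W = 0 := hker Submodule.mem_top
  rw [tensorForm_apply, Fintype.sum_eq_single l, Fintype.sum_eq_single k] at h
  · simpa using h
  · intro k' hk'
    simp [hk']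
  · intro l' hl'
    refine Finset.sum_eq_zero fun k' _ => ?_
    rcases eq_or_ne k' k with rfl | hk' <;> simp [*]

end Response

/-! ### The code of the decoding equations -/

/-- A code has strength `T` if its projection to any `T` coordinates is surjective. -/
def HasStrength {F : Type} [Field F] {N : ℕ} (C : Submodule F (Fin N → F)) (T : ℕ) : Prop :=
  ∀ J : Finset (Fin N), J.card = T → ∀ v : Fin N → F, ∃ y ∈ C, ∀ j ∈ J, y j = v j

/-- Any `T` columns of the matrix are linearly independent. -/
def ColsIndependent {F : Type} [Field F] {N : ℕ} (T : ℕ) (P : Matrix (Fin N) (Fin N) F) : Prop :=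
  ∀ J : Finset (Fin N), J.card = T → ∀ a : Fin N → F, (∀ j ∉ J, a j = 0) →
    (∀ i, ∑ j, a j * P i j = 0) → a = 0

theorem colsIndependent_one {F : Type} [Field F] {N : ℕ} (T : ℕ) :
    ColsIndependent T (1 : Matrix (Fin N) (Fin N) F) := by
  intro J _ a _ h
  ext i
  simpa [Matrix.one_apply] using h i

/-- A projection onto `C` yields a matrix with rows in `C` whose columns inherit the strength. -/
theorem HasStrength.exists_matrix {F : Type} [Field F] {N : ℕ} {C : Submodule F (Fin N → F)}
    {T : ℕ} (hC : HasStrength C T) :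
    ∃ P : Matrix (Fin N) (Fin N) F, (∀ i, P i ∈ C) ∧ ColsIndependent T P := by
  classical
  obtain ⟨p, hp⟩ := C.subtype.exists_leftInverse_of_injective C.ker_subtype
  refine ⟨Matrix.of fun i => (p (Pi.single i 1) : Fin N → F), fun i => (p (Pi.single i 1)).2,
    fun J hJ a ha h => ?_⟩
  have hall : ∀ z : Fin N → F, ∑ j, a j * (p z : Fin N → F) j = 0 := by
    intro z
    have hz : z = ∑ i, z i • (Pi.single i 1 : Fin N → F) := by
      ext j
      simp [Finset.sum_apply, Pi.single_apply]
    have : (p z : Fin N → F) = ∑ i, z i • (p (Pi.single i 1) : Fin N → F) := by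
      conv_lhs => rw [hz]
      simp
    rw [this]
    simp only [Finset.sum_apply, Pi.smul_apply, smul_eq_mul, Finset.mul_sum]
    rw [Finset.sum_comm]
    refine Finset.sum_eq_zero fun i _ => ?_
    rw [← mul_zero (z i), ← h i, Finset.mul_sum]
    exact Finset.sum_congr rfl fun j _ => by simp only [Matrix.of_apply]; ring
  ext j₀
  by_cases hj₀ : j₀ ∈ J
  · obtain ⟨y, hy, hyJ⟩ := hC J hJ (Pi.single j₀ 1)
    have hpy : (p y : Fin N → F) = y := congrArg Subtype.val (LinearMap.congr_fun hp ⟨y, hy⟩)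
    have h0 := hall y
    rw [hpy, Fintype.sum_eq_single j₀] at h0
    · simpa [hyJ j₀ hj₀] using h0
    · intro j hj
      by_cases hjJ : j ∈ J
      · simp [hyJ j hjJ, hj]
      · simp [ha j hjJ]
  · exact ha j₀ hj₀

section Decoding

variable {F : Type} [Field F] {N K : ℕ} [NeZero N] (G : Matrix (Fin K) (Fin N) F)

/-- The vectors `y` in `F ^ N` for which the multiples `y i • G · i` of the columns of `G` satisfy
the decoding equations with coefficients `α`. -/
def decodingCode (r : ℕ) (c : Fin N) (α : Fin N → Fin N → F) : Submodule F (Fin N → F) where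
  carrier := {y | ∀ i, ¬ IsNoise r c i → ∀ k, G k i * y i =
    ∑ j ∈ Finset.univ.filter (fun j => IsNoise r c j), α i j * (G k j * y j)}
  add_mem' {y z} hy hz i hi k := by
    simp only [Pi.add_apply, mul_add, hy i hi k, hz i hi k, Finset.sum_add_distrib]
  zero_mem' i _ k := by simp
  smul_mem' a y hy i hi k := by
    simp only [Pi.smul_apply, smul_eq_mul, mul_left_comm _ a, hy i hi k, ← Finset.mul_sum]

theorem mem_decodingCode {r : ℕ} {c : Fin N} {α : Fin N → Fin N → F} {y : Fin N → F} :
    y ∈ decodingCode G r c α ↔ ∀ i, ¬ IsNoise r c i → ∀ k, G k i * y i =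
      ∑ j ∈ Finset.univ.filter (fun j => IsNoise r c j), α i j * (G k j * y j) :=
  Iff.rfl

variable {G}

theorem exists_not_isNoise {r : ℕ} (hr : r < N) (c : Fin N) : ∃ i, ¬ IsNoise r c i := by
  refine ⟨c + ⟨r, hr⟩, ?_⟩
  rw [IsNoise, add_sub_cancel_left]
  exact lt_irrefl r

/-- At a coordinate outside message `0` the noise queries form a word of the decoding code, and
they agree there with the queries sent, any `T` of which are uniform. -/
theorem OneShotScheme.hasStrength [Fintype F] {T r M ℓ : ℕ} [NeZero M] {c : Fin N} (hr : r < N)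
    (hM : 2 ≤ M) (Q : OneShotScheme G T r c M ℓ) :
    HasStrength (decodingCode G r c Q.coeff) T := by
  have : Nontrivial (Fin M) := Fin.nontrivial_iff_two_le.2 hM
  obtain ⟨m, hm⟩ := exists_ne (0 : Fin M)
  have hℓ : 0 < ℓ := by
    obtain ⟨i, hi⟩ := exists_not_isNoise hr c
    obtain ⟨ω, hω⟩ := Q.law.support_nonempty
    refine Nat.pos_of_ne_zero fun h0 => (Q.independent ω hω).ne_zero ⟨i, hi⟩ ?_
    subst h0
    refine LinearMap.ext fun W => ?_
    simp [response]
  intro J hJ v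
  have hmem : (fun (j : J) _ _ => v j : J → Query F M ℓ) ∈ (Q.law.map (fun ω (j : J) =>
      if IsNoise r c (j : Fin N) then ω.1 j else ω.1 j + ω.2 j)).support := by
    rw [Q.uniform J hJ]
    exact PMF.mem_support_uniformOfFintype _
  rw [PMF.support_map] at hmem
  obtain ⟨ω, hω, heq⟩ := hmem
  refine ⟨fun j => ω.1 j m ⟨0, hℓ⟩, fun i hi k => ?_, fun j hj => ?_⟩
  · exact (response_eq_sum_iff G i _ _ _).1 (Q.decoding ω hω i hi) m k ⟨0, hℓ⟩
  · have h := congrFun (congrFun (congrFun heq ⟨j, hj⟩) m) ⟨0, hℓ⟩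
    by_cases hn : IsNoise r c j
    · simpa [hn] using h
    · simpa [hn, Q.informative ω hω j hn m hm] using h

/-- One-shot schemes need noise servers: without them the decoding equations say that the noise
queries vanish. -/
theorem OneShotScheme.codimension_pos [Fintype F] {T r M ℓ : ℕ} [NeZero M] {c : Fin N}
    (hK : 1 ≤ K) (hKN : K ≤ N) (hT : 1 ≤ T) (hTN : T ≤ N) (hr : r < N) (hM : 2 ≤ M) (hG : IsMDS G)
    (Q : OneShotScheme G T r c M ℓ) : 1 ≤ r := by
  by_contra h
  have hr0 : r = 0 := by omega
  subst hr0
  have hnoise : ∀ j, ¬ IsNoise 0 c j := fun j => Nat.not_lt_zero _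
  obtain ⟨J, -, hJ⟩ := Finset.exists_subset_card_eq
    (show T ≤ (Finset.univ : Finset (Fin N)).card by simpa using hTN)
  obtain ⟨j, hj⟩ := Finset.card_pos.1 (show 0 < J.card by omega)
  obtain ⟨y, hy, hyj⟩ := Q.hasStrength hr hM J hJ fun _ => 1
  obtain ⟨s, hjs, hs⟩ := Finset.exists_superset_card_eq
    (show ({j} : Finset (Fin N)).card ≤ K by simpa using hK) (by simpa using hKN)
  have hcol : (fun k => G k j) ≠ 0 := (hG s hs).ne_zero ⟨j, by simpa using hjs⟩
  apply hcol
  ext k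
  have := hy j (hnoise j) k
  simpa [hnoise, hyj j hj] using this

/-- For `K = 1` the storage code is a repetition code up to scaling, so that the servers of a
one-shot scheme can be shifted cyclically. -/
theorem OneShotScheme.nonempty_shift [Fintype F] {T r M ℓ : ℕ} [NeZero M] (hK : K = 1)
    (hG : IsMDS G) (Q : OneShotScheme G T r (0 : Fin N) M ℓ) (c : Fin N) :
    Nonempty (OneShotScheme G T r c M ℓ) := by
  classical
  subst hK
  have hG0 : ∀ j, G 0 j ≠ 0 := by
    intro j h0
    refine (hG {j} (by simp)).ne_zero ⟨j, by simp⟩ ?_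
    ext k
    rw [Subsingleton.elim k 0]
    exact h0
  -- The factor that turns a response of server `j - c` into one of server `j`.
  let a (j : Fin N) : F := G 0 (j - c) / G 0 j
  have ha : ∀ j, a j ≠ 0 := fun j => div_ne_zero (hG0 _) (hG0 _)
  have hresp : ∀ j (q : Query F M ℓ), response G j (a j • q) = response G (j - c) q := by
    intro j q
    refine LinearMap.ext fun W => ?_
    simp only [response_apply]
    refine Finset.sum_congr rfl fun m _ => ?_
    congr 2
    ext k l
    rw [Subsingleton.elim k 0]
    simp only [Pi.smul_apply, smul_eq_mul, a]
    field_simp [hG0 j]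
  have hnoise : ∀ j, IsNoise r c j ↔ IsNoise r 0 (j - c) := by
    intro j
    rw [IsNoise, IsNoise, sub_zero]
  let shift (ω : (Fin N → Query F M ℓ) × (Fin N → Query F M ℓ)) :
      (Fin N → Query F M ℓ) × (Fin N → Query F M ℓ) :=
    (fun j => a j • ω.1 (j - c), fun j => a j • ω.2 (j - c))
  have hsupp : ∀ ω ∈ (Q.law.map shift).support, ∃ ω' ∈ Q.law.support, shift ω' = ω := by
    intro ω hω
    rwa [PMF.support_map] at hω
  refine ⟨⟨Q.law.map shift, fun i j => Q.coeff (i - c) (j - c), ?_, ?_, ?_, ?_⟩⟩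
  · intro ω hω i hi
    obtain ⟨ω, hω', rfl⟩ := hsupp ω hω
    exact Submodule.smul_mem _ _ (Q.informative ω hω' (i - c) ((hnoise i).not.1 hi))
  · intro J hJ
    let J' : Finset (Fin N) := J.map (Equiv.subRight c).toEmbedding
    have hJ' : J'.card = T := by rw [Finset.card_map, hJ]
    have hmemJ : ∀ j, j ∈ J ↔ j - c ∈ J' := by
      intro j
      simp [J']
    let eJ : J ≃ J' := (Equiv.subRight c).subtypeEquiv hmemJ
    let e : (J' → Query F M ℓ) ≃ (J → Query F M ℓ) :=
      (Equiv.arrowCongr eJ.symm (Equiv.refl _)).trans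
        (Equiv.piCongrRight fun j : J => MulAction.toPerm (Units.mk0 (a j) (ha j)))
    rw [← PMF.map_uniformOfFintype_equiv e, ← Q.uniform J' hJ', PMF.map_comp, PMF.map_comp]
    congr 1
    ext1 ω
    ext1 j
    change (if IsNoise r c (j : Fin N) then a j • ω.1 (j - c) else
        a j • ω.1 (j - c) + a j • ω.2 (j - c)) =
      a j • (if IsNoise r 0 ((j : Fin N) - c) then ω.1 (j - c) else ω.1 (j - c) + ω.2 (j - c))
    simp only [hnoise, smul_ite, smul_add]
  · intro ω hω
    obtain ⟨ω, hω', rfl⟩ := hsupp ω hω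
    have h := (Q.independent ω hω').comp
      (fun i : {i : Fin N // ¬ IsNoise r c i} => ⟨i.1 - c, (hnoise i.1).not.1 i.2⟩)
      fun i j hij => Subtype.ext (sub_left_injective (congrArg Subtype.val hij))
    simp only [shift, hresp]
    exact h
  · intro ω hω i hi
    obtain ⟨ω, hω', rfl⟩ := hsupp ω hω
    simp only [shift, hresp]
    rw [Q.decoding ω hω' (i - c) ((hnoise i).not.1 hi)]
    refine (Finset.sum_equiv (Equiv.subRight c) ?_ ?_).symm
    · intro j
      simp [hnoise]
    · intro j _
      rfl

end Decoding

/-! ### The seed combinations sent to the servers -/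

namespace Seed

variable {F : Type} [Field F] {N K n : ℕ}

/-- The combination of seeds used for the query with label `s`: for each position `(x, b)`, the
seeds `(i, x, b)` of the `N` servers are encoded with the matrix `P b`. -/
def encode (P : Fin n → Matrix (Fin N) (Fin N) F) (s : Seed N K n) : Seed N K n → F :=
  fun s' => if s'.2 = s.2 then P s.2.2 s'.1 s.1 else 0

theorem encode_one (s : Seed N K n) :
    encode (fun _ => (1 : Matrix (Fin N) (Fin N) F)) s = Pi.single s 1 := by
  ext s'
  by_cases h : s' = s
  · subst h
    simp [encode]
  · rw [Pi.single_eq_of_ne h, encode]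
    split_ifs with h2
    · exact Matrix.one_apply_ne fun h1 => h (Prod.ext h1 h2)
    · rfl

theorem linearIndependent_encode {T : ℕ} {P : Fin n → Matrix (Fin N) (Fin N) F}
    (hP : ∀ b, ColsIndependent T (P b)) {J : Finset (Fin N)} (hJ : J.card = T) :
    LinearIndependent F (fun s : {s : Seed N K n // s.1 ∈ J} => encode P s.1) := by
  classical
  rw [Fintype.linearIndependent_iff]
  intro a ha
  let A (s : Seed N K n) : F := if h : s.1 ∈ J then a ⟨s, h⟩ else 0
  have hsum : ∑ s, A s • encode P s = 0 := by
    rw [← ha, ← Finset.sum_filter_add_sum_filter_not Finset.univ fun s : Seed N K n => s.1 ∈ J,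
      Finset.sum_subtype (p := fun s : Seed N K n => s.1 ∈ J) _ (by simp), add_eq_left.2]
    · exact Finset.sum_congr rfl fun s _ => by simp only [A, dif_pos s.2]
    · refine Finset.sum_eq_zero fun s hs => ?_
      simp only [A, dif_neg (Finset.mem_filter.1 hs).2, zero_smul]
  have hA : ∀ x b j, A (j, x, b) = 0 := by
    intro x b j
    refine congrFun (hP b J hJ (fun j => A (j, x, b)) (fun j hj => dif_neg hj) fun i => ?_) j
    have h := congrFun hsum (i, x, b)
    simp only [Finset.sum_apply, Pi.smul_apply, smul_eq_mul, encode, Pi.zero_apply,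
      Fintype.sum_prod_type, Prod.mk.injEq] at h
    rw [← h]
    refine Finset.sum_congr rfl fun j _ => ?_
    rw [Fintype.sum_eq_single x, Fintype.sum_eq_single b]
    · simp
    · intro b' hb'
      simp [hb'.symm]
    · intro x' hx'
      simp [hx'.symm]
  rintro ⟨⟨j, x, b⟩, hj⟩
  simpa [A, hj] using hA x b j

/-- The rows of `P b` are words of a code, hence every linear relation of the code holds between
the encoded seeds of the servers. -/
theorem sum_smul_encode {P : Fin n → Matrix (Fin N) (Fin N) F} {x : Fin K} {b : Fin n}
    {a : F} {i : Fin N} {J : Finset (Fin N)} {α : Fin N → F}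
    (h : ∀ i', a * P b i' i = ∑ j ∈ J, α j * P b i' j) :
    a • encode P (i, x, b) = ∑ j ∈ J, α j • encode P (j, x, b) := by
  ext s'
  simp only [Pi.smul_apply, Finset.sum_apply, smul_eq_mul, encode]
  split_ifs
  · exact h s'.1
  · simp

end Seed

section Scheme

variable {F : Type} [Field F] {N K n M ℓ e : ℕ}

/-- The queries of the lifted scheme. The component at message `m'` of a query that involves `m'`
is the image of the combination of seeds with the label of the query under the random automorphism
`g m'` and under the linear map chosen by the repetition. -/
def liftQuery (u : Fin e → (Seed N K n → F) →ₗ[F] (Fin ℓ → F)) (S : SymMatrix N)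
    (P : Fin M → Fin n → Matrix (Fin N) (Fin N) F)
    (ψ : Fin M → Fin N → ℕ × Finset (Fin M) → Fin n)
    (g : Fin M → (Seed N K n → F) ≃ₗ[F] (Seed N K n → F)) (j : Fin N) (x : Slot S M (e * K) j) :
    Query F M ℓ :=
  fun m' => if m' ∈ x.1.2.2 then
    u (finProdFinEquiv.symm x.1.1).1 (g m' (Seed.encode (P m')
      (j, (finProdFinEquiv.symm x.1.1).2, ψ m' j (x.1.2.1, x.1.2.2)))) else 0

theorem Slot.mem_slotsWith {S : SymMatrix N} {ρ : ℕ} {m : Fin M} {j : Fin N} (x : Slot S M ρ j)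
    (hm : m ∈ x.1.2.2) : ((x.1.2.1 : ℕ), x.1.2.2) ∈ S.slotsWith m j :=
  SymMatrix.mem_slotsWith.2 ⟨x.1.2.1.isLt, hm, x.2.2⟩

theorem isSumQuery_of_forall_eq_zero {I : Finset (Fin M)} {q : Query F M ℓ}
    (h : ∀ m ∉ I, q m = 0) : IsSumQuery I q := by
  refine ⟨fun m => Pi.single m (q m), fun m _ m' hm' => Pi.single_eq_of_ne hm' _, ?_⟩
  ext1 m
  rw [Finset.sum_apply]
  by_cases hm : m ∈ I
  · rw [Finset.sum_eq_single_of_mem m hm]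
    · simp
    · intro m' _ hm'
      exact Pi.single_eq_of_ne hm'.symm _
  · rw [h m hm, Finset.sum_eq_zero]
    intro m' hm'
    exact Pi.single_eq_of_ne (by rintro rfl; exact hm hm') _

theorem linearIndependent_encode_slotsWith {T : ℕ} {S : SymMatrix N} {m : Fin M}
    {P : Fin n → Matrix (Fin N) (Fin N) F} {ψ : Fin N → ℕ × Finset (Fin M) → Fin n}
    (hP : ∀ b, ColsIndependent T (P b)) (hψ : ∀ j, Set.InjOn (ψ j) (S.slotsWith m j))
    {J : Finset (Fin N)} (hJ : J.card = T) :
    LinearIndependent F (fun z : {z : Fin N × Fin K × ℕ × Finset (Fin M) //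
      z.1 ∈ J ∧ z.2.2 ∈ S.slotsWith m z.1} =>
        Seed.encode P ((z.1.1, z.1.2.1, ψ z.1.1 z.1.2.2) : Seed N K n)) := by
  have hinj : Function.Injective (fun z : {z : Fin N × Fin K × ℕ × Finset (Fin M) //
      z.1 ∈ J ∧ z.2.2 ∈ S.slotsWith m z.1} =>
        (⟨(z.1.1, z.1.2.1, ψ z.1.1 z.1.2.2), z.2.1⟩ : {s : Seed N K n // s.1 ∈ J})) := by
    intro z z' h
    have h1 : ((z.1.1, z.1.2.1, ψ z.1.1 z.1.2.2) : Seed N K n) =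
        (z'.1.1, z'.1.2.1, ψ z'.1.1 z'.1.2.2) := congrArg Subtype.val h
    have hj : z.1.1 = z'.1.1 := (Prod.mk.inj h1).1
    have hx : z.1.2.1 = z'.1.2.1 := (Prod.mk.inj (Prod.mk.inj h1).2).1
    have hb : ψ z.1.1 z.1.2.2 = ψ z'.1.1 z'.1.2.2 := (Prod.mk.inj (Prod.mk.inj h1).2).2
    rw [← hj] at hb
    have hz' := z'.2.2
    rw [← hj] at hz'
    exact Subtype.ext (Prod.ext hj (Prod.ext hx (hψ _ z.2.2 hz' hb)))
  have h := (Seed.linearIndependent_encode (K := K) hP hJ).comp _ hinj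
  exact h

/-- Any `T` servers see, up to a fixed automorphism which the random automorphisms absorb, the same
queries for all encoding matrices with independent columns and all injective labellings. -/
theorem map_liftQuery_restrict_eq [Fintype F]
    [Fintype ((Seed N K n → F) ≃ₗ[F] (Seed N K n → F))]
    (u : Fin e → (Seed N K n → F) →ₗ[F] (Fin ℓ → F)) (S : SymMatrix N) {T : ℕ}
    {P P' : Fin M → Fin n → Matrix (Fin N) (Fin N) F}
    {ψ ψ' : Fin M → Fin N → ℕ × Finset (Fin M) → Fin n}
    (hP : ∀ m b, ColsIndependent T (P m b)) (hP' : ∀ m b, ColsIndependent T (P' m b))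
    (hψ : ∀ m j, Set.InjOn (ψ m j) (S.slotsWith m j))
    (hψ' : ∀ m j, Set.InjOn (ψ' m j) (S.slotsWith m j))
    {J : Finset (Fin N)} (hJ : J.card = T) :
    (PMF.uniformOfFintype (Fin M → (Seed N K n → F) ≃ₗ[F] (Seed N K n → F))).map
        (fun g (j : J) => liftQuery u S P ψ g j) =
      (PMF.uniformOfFintype (Fin M → (Seed N K n → F) ≃ₗ[F] (Seed N K n → F))).map
        (fun g (j : J) => liftQuery u S P' ψ' g j) := by
  classical
  choose h hh using fun m => exists_linearEquiv_apply_eq 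
    (linearIndependent_encode_slotsWith (K := K) (hP m) (hψ m) hJ)
    (linearIndependent_encode_slotsWith (hP' m) (hψ' m) hJ)
  refine PMF.map_uniformOfFintype_eq (Equiv.mulRight h) fun g => ?_
  ext j x m : 3
  simp only [liftQuery, Equiv.coe_mulRight, Pi.mul_apply]
  split_ifs with hm
  · rw [← hh m ⟨(j.1, (finProdFinEquiv.symm x.1.1).2, (x.1.2.1.val, x.1.2.2)), j.2,
      x.mem_slotsWith hm⟩]
    rfl
  · rfl

theorem linearIndependent_response_liftQuery {G : Matrix (Fin K) (Fin N) F}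
    {u : Fin e → (Seed N K n → F) →ₗ[F] (Fin ℓ → F)} {m : Fin M}
    {g : Fin M → (Seed N K n → F) ≃ₗ[F] (Seed N K n → F)}
    (hu : LinearIndependent F (fun (x : Fin e × Seed N K n) (k : Fin K) (l : Fin ℓ) =>
      G k x.2.1 * u x.1 (g m (Pi.single x.2 1)) l))
    {S : SymMatrix N} {P : Fin M → Fin n → Matrix (Fin N) (Fin N) F}
    {ψ : Fin M → Fin N → ℕ × Finset (Fin M) → Fin n} (hP : P m = fun _ => 1)
    (hψ : ∀ j, Set.InjOn (ψ m j) (S.slotsWith m j)) :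
    LinearIndependent F
      (fun x : {x : (Σ j, Slot S M (e * K) j) // m ∈ x.2.1.2.2} =>
        response (K := K) G x.1.1 (Pi.single m (liftQuery u S P ψ g x.1.1 x.1.2 m))) := by
  have h1 := (hu.comp (fun x : {x : (Σ j, Slot S M (e * K) j) // m ∈ x.2.1.2.2} =>
    ((finProdFinEquiv.symm x.1.2.1.1).1, (x.1.1, (finProdFinEquiv.symm x.1.2.1.1).2,
      ψ m x.1.1 (x.1.2.1.2.1, x.1.2.1.2.2)))) ?_).map' (tensorForm m) (tensorForm_injective m)
  · have h2 : ∀ f, (⇑(tensorForm m) ∘ _) = f → LinearIndependent F f := fun f hf => hf ▸ h1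
    refine h2 _ ?_
    funext x
    rw [response_single_message]
    simp only [liftQuery, if_pos x.2, hP, Seed.encode_one]
    rfl
  · rintro ⟨⟨j, x⟩, hx⟩ ⟨⟨j', x'⟩, hx'⟩ h
    simp only [Prod.mk.injEq] at h
    obtain ⟨h1, rfl, h2, h3⟩ := h
    have hp : x.1.1 = x'.1.1 := finProdFinEquiv.symm.injective (Prod.ext h1 h2)
    have hy := hψ j (x.mem_slotsWith hx) (x'.mem_slotsWith hx') h3
    have hxx : x = x' := by
      refine Subtype.ext (Prod.ext hp (Prod.ext (Fin.ext (Prod.mk.inj hy).1) ?_))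
      exact (Prod.mk.inj hy).2
    subst hxx
    rfl

theorem response_liftQuery [NeZero N] {G : Matrix (Fin K) (Fin N) F} {r : ℕ}
    {u : Fin e → (Seed N K n → F) →ₗ[F] (Fin ℓ → F)} {m : Fin M}
    {g : Fin M → (Seed N K n → F) ≃ₗ[F] (Seed N K n → F)}
    {S : SymMatrix N} {P : Fin M → Fin n → Matrix (Fin N) (Fin N) F}
    {ψ : Fin M → Fin N → ℕ × Finset (Fin M) → Fin n} {α : Fin N → Fin N → F}
    {B : Block N} {I : Finset (Fin M)} (hm : m ∉ I)
    (hψ : ∀ m' ∈ I, ∃ b, (∀ j, ψ m' j (Block.slot r m j (B, I)) = b) ∧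
      ∀ i, P m' b i ∈ decodingCode G r B.offset α)
    {p : Fin (e * K)} (x : ∀ j, Slot S M (e * K) j)
    (hx : ∀ j, (x j).1.1 = p ∧ ((x j).1.2.1 : ℕ) = B.row j ∧
        (x j).1.2.2 = if IsNoise r B.offset j then I else insert m I)
    {i : Fin N} (hi : ¬ IsNoise r B.offset i) :
    response G i (Function.update (liftQuery u S P ψ g i (x i)) m 0) =
      ∑ j ∈ Finset.univ.filter (fun j => IsNoise r B.offset j),
        α i j • response G j (liftQuery u S P ψ g j (x j)) := by
  rw [response_eq_sum_iff]
  intro m' k l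
  have hval : ∀ j, m' ≠ m → liftQuery u S P ψ g j (x j) m' = if m' ∈ I then
      u (finProdFinEquiv.symm p).1 (g m' (Seed.encode (P m')
        (j, (finProdFinEquiv.symm p).2, ψ m' j (Block.slot r m j (B, I))))) else 0 := by
    intro j hm'
    have hmem : m' ∈ (x j).1.2.2 ↔ m' ∈ I := by
      rw [(hx j).2.2]
      split_ifs
      · rfl
      · simp [hm']
    have hslot : ((x j).1.2.1.val, (x j).1.2.2) = Block.slot r m j (B, I) :=
      Prod.ext (hx j).2.1 (hx j).2.2
    simp only [liftQuery, hmem, hslot, (hx j).1]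
  have hnoise : ∀ j ∈ Finset.univ.filter (fun j => IsNoise r B.offset j),
      m ∉ (x j).1.2.2 := by
    intro j hj
    rw [(hx j).2.2, if_pos (by simpa using hj)]
    exact hm
  by_cases hm' : m' = m
  · subst hm'
    rw [Function.update_self, Finset.sum_eq_zero]
    · simp
    · intro j hj
      simp [liftQuery, hnoise j hj]
  · rw [Function.update_of_ne hm', hval i hm']
    rw [Finset.sum_congr rfl fun j _ => by rw [hval j hm']]
    by_cases hI : m' ∈ I
    · obtain ⟨b, hb, hPb⟩ := hψ m' hI
      simp only [if_pos hI, hb]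
      have h := Seed.sum_smul_encode (P := P m') (x := (finProdFinEquiv.symm p).2)
        (a := G k i) (α := fun j => α i j * G k j) fun i' => by
          simpa only [mul_assoc] using (mem_decodingCode G).1 (hPb i') i hi k
      have h2 := congrFun (congrArg (fun v => u (finProdFinEquiv.symm p).1 (g m' v)) h) l
      simpa [mul_assoc] using h2
    · simp [hI]

end Scheme

/-! ### The number of queries -/

section Count

variable {N r M : ℕ}

/-- The queries that involve message `m`, grouped by repetition. -/
def slotEquiv (S : SymMatrix N) (ρ : ℕ) (m : Fin M) :
    {x : (Σ j, Slot S M ρ j) // m ∈ x.2.1.2.2} ≃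
      Fin ρ × Σ j, {y // y ∈ S.slotsWith m j} where
  toFun x := (x.1.2.1.1, ⟨x.1.1, ⟨(x.1.2.1.2.1, x.1.2.1.2.2), x.1.2.mem_slotsWith x.2⟩⟩)
  invFun z := ⟨⟨z.2.1, ⟨(z.1, ⟨z.2.2.1.1, (SymMatrix.mem_slotsWith.1 z.2.2.2).1⟩, z.2.2.1.2),
    ⟨m, (SymMatrix.mem_slotsWith.1 z.2.2.2).2.1⟩, (SymMatrix.mem_slotsWith.1 z.2.2.2).2.2⟩⟩,
    (SymMatrix.mem_slotsWith.1 z.2.2.2).2.1⟩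
  left_inv _ := rfl
  right_inv _ := rfl

theorem card_filter_nonempty_card_eq_succ (M k : ℕ) :
    (Finset.univ.filter fun I : Finset (Fin M) => I.Nonempty ∧ I.card = k + 1).card =
      M.choose (k + 1) := by
  have h : (Finset.univ.filter fun I : Finset (Fin M) => I.Nonempty ∧ I.card = k + 1) =
      Finset.powersetCard (k + 1) Finset.univ := by
    ext I
    simp only [Finset.mem_filter, Finset.mem_univ, true_and, Finset.mem_powersetCard,
      Finset.subset_univ, and_iff_right_iff_imp]
    intro hI
    exact Finset.card_pos.1 (by omega)
  rw [h, Finset.card_powersetCard, Finset.card_univ, Fintype.card_fin]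

theorem card_slot (S : SymMatrix N) (ρ : ℕ) (j : Fin N) :
    Fintype.card (Slot S M ρ j) = ρ * ∑ i : Fin S.length, (Finset.univ.filter
      fun I : Finset (Fin M) => I.Nonempty ∧ I.card = S.entry i j).card := by
  rw [Fintype.card_subtype, Finset.card_filter, Fintype.sum_prod_type]
  simp only [Fintype.sum_prod_type, Finset.card_filter]
  have h : ∀ c : ℕ, ρ * c = ∑ _p : Fin ρ, c := fun c => by simp
  rw [h]

variable [NeZero N]

theorem card_slots_involving (hrN : r ≤ N) (hM : 2 ≤ M) (ρ : ℕ) (m : Fin M) :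
    Fintype.card {x : (Σ j, Slot (SymMatrix.ofMessages N r M) M ρ j) // m ∈ x.2.1.2.2} =
      ρ * N ^ (M - 1) := by
  rw [Fintype.card_congr (slotEquiv _ ρ m), Fintype.card_prod, Fintype.card_fin,
    Fintype.card_sigma, ← SymMatrix.sum_card_slotsWith hrN hM m]
  simp only [Fintype.card_coe]

/-- `S_M` has `r ^ (M - k) * (N - r) ^ (k - 1)` entries `k`, each of which stands for `M.choose k`
queries, and the binomial theorem adds them up. -/
theorem sum_card_slot (hrN : r ≤ N) (hM : 2 ≤ M) (ρ : ℕ) :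
    (N - r) * (∑ j, Fintype.card (Slot (SymMatrix.ofMessages N r M) M ρ j)) + ρ * r ^ M =
      ρ * N ^ M := by
  have h := weight_ofMessages (N := N) (r := r) hrN hM
    (w := fun k => (Finset.univ.filter fun I : Finset (Fin M) => I.Nonempty ∧ I.card = k).card) (by
      rw [Finset.card_eq_zero, Finset.filter_eq_empty_iff]
      rintro I - ⟨hI, h0⟩
      exact hI.ne_empty (Finset.card_eq_zero.1 h0))
  simp only [card_filter_nonempty_card_eq_succ] at h
  rw [SymMatrix.weight_eq_sum, Finset.sum_comm] at h
  simp only [card_slot]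
  rw [← Finset.mul_sum, h]
  have hbin := add_pow (N - r) r M
  rw [Nat.sub_add_cancel hrN, Finset.sum_range_succ'] at hbin
  rw [hbin, mul_add, mul_left_comm, Finset.mul_sum]
  congr 2
  · refine Finset.sum_congr rfl fun k hk => ?_
    rw [show M - 1 - k = M - (k + 1) by omega, pow_succ, Nat.cast_id]
    ring
  · simp

end Count

/-! ### Correctness and privacy -/

theorem Scheme.correct_of_forall_eq {F : Type} [Field F] [Fintype F] {N K : ℕ} {ι : Fin N → Type}
    [∀ j, Fintype (ι j)] [∀ j, DecidableEq (ι j)] {M ℓ : ℕ} {Q : Scheme F ι M ℓ}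
    {G : Matrix (Fin K) (Fin N) F}
    (h : ∀ m, ∀ q ∈ (Q m).support, ∀ W W' : Database F M K ℓ,
      (∀ j i, response G j (q j i) W = response G j (q j i) W') → W m = W' m) : Q.Correct G := by
  intro m
  refine condEntropy_eq_zero _ ?_
  intro z hz z' hz' hzz
  simp only [PMF.mem_support_bind_iff, PMF.support_map] at hz hz'
  obtain ⟨W, -, q, hq, rfl⟩ := hz
  obtain ⟨W', -, q', hq', rfl⟩ := hz'
  simp only [Prod.mk.injEq] at hzz
  obtain ⟨rfl, hresp⟩ := hzz
  exact Prod.ext (h m q hq W W' fun j i => congrFun (congrFun hresp j) i) (Prod.ext rfl hresp)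

/-- A scheme which interprets `S_M` and whose number of queries involving a message equals the
message length is correct: the decoding equations compute the interference from the leftovers, and
what remains of the queries involving the desired message are as many independent forms in this
message as it has symbols. -/
theorem IsLifted.correct {F : Type} [Field F] [Fintype F] {N K r M ℓ ρ : ℕ} [NeZero N]
    {G : Matrix (Fin K) (Fin N) F} {β : Fin N → Fin N → Fin N → F}
    {Q : Scheme F (Slot (SymMatrix.ofMessages N r M) M ρ) M ℓ} (hQ : IsLifted G r M ℓ ρ β Q)
    (hr : 1 ≤ r) (hrN : r ≤ N) (hM : 2 ≤ M) (hℓ : K * ℓ = ρ * N ^ (M - 1)) : Q.Correct G := by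
  have hblock := isBlockSystem_ofMessages (N := N) hr hrN hM
  refine Scheme.correct_of_forall_eq fun m q hq W W' hresp => ?_
  have hD : ∀ j (x : Slot (SymMatrix.ofMessages N r M) M ρ j),
      response G j (q j x) (W - W') = 0 := by
    intro j x
    rw [map_sub, sub_eq_zero]
    exact hresp j x
  have hint : ∀ j (x : Slot (SymMatrix.ofMessages N r M) M ρ j), m ∈ x.1.2.2 →
      response G j (Function.update (q j x) m 0) (W - W') = 0 := by
    intro j x hx
    have hcard := Finset.card_erase_add_one hx
    -- Queries for `{m}` alone carry no interference; all others lie in a block of level `card - 1`.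
    rcases Nat.eq_zero_or_pos (x.1.2.2.erase m).card with h0 | hpos
    · have hI : x.1.2.2 = {m} := by
        rw [← Finset.insert_erase hx, Finset.card_eq_zero.1 h0]
        rfl
      obtain ⟨v, hv, hqv⟩ := hQ.1 m q hq j x
      have : Function.update (q j x) m 0 = 0 := by
        ext1 m'
        by_cases hm' : m' = m
        · subst hm'
          simp
        · rw [Function.update_of_ne hm', hqv, hI, Finset.sum_singleton]
          exact hv m hx m' hm'
      rw [this, response_apply]
      simp [tensorForm_apply]
    · have hkM : (x.1.2.2.erase m).card < M := by
        have := Finset.card_lt_univ_of_notMem (Finset.notMem_erase m x.1.2.2)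
        rwa [Fintype.card_fin] at this
      have hentry : (SymMatrix.ofMessages N r M).entry x.1.2.1 j = (x.1.2.2.erase m).card + 1 := by
        rw [hcard, x.2.2]
      obtain ⟨B, hB, hBk, hBj⟩ := hblock.exists_block j x.1.2.1 x.1.2.1.isLt _ hpos hkM
        (Or.inr hentry)
      have hj : ¬ IsNoise r B.offset j := by
        intro hn
        have := hblock.entry_row B hB j
        rw [if_pos hn, hBj, hentry, hBk] at this
        omega
      let y (i : Fin N) : Slot (SymMatrix.ofMessages N r M) M ρ i :=
        ⟨(x.1.1, ⟨B.row i, hblock.row_lt B hB i⟩,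
          if IsNoise r B.offset i then x.1.2.2.erase m else insert m (x.1.2.2.erase m)), by
          have := hblock.entry_row B hB i
          constructor
          · split_ifs
            · exact Finset.card_pos.1 hpos
            · exact Finset.insert_nonempty _ _
          · simp only [this]
            split_ifs
            · exact hBk.symm
            · rw [Finset.card_insert_of_notMem (Finset.notMem_erase m _), hBk]⟩
      have hyx : y j = x := by
        refine Subtype.ext (Prod.ext rfl (Prod.ext (Fin.ext hBj) ?_))
        simp only [y, if_neg hj]
        exact Finset.insert_erase hx
      have hdec := hQ.2.2 m q hq B hB x.1.1 (x.1.2.2.erase m) (Finset.notMem_erase m _) hBk.symm y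
        (fun i => ⟨rfl, rfl, rfl⟩) j hj
      rw [hyx] at hdec
      rw [hdec]
      simp [hD]
  have hdes : ∀ j (x : Slot (SymMatrix.ofMessages N r M) M ρ j), m ∈ x.1.2.2 →
      tensorForm m (fun k l => G k j * q j x m l) (W - W') = 0 := by
    intro j x hx
    have hsplit := response_apply G j (q j x) (W - W')
    have hsplit' := response_apply G j (Function.update (q j x) m 0) (W - W')
    rw [hD, ← Finset.add_sum_erase _ _ (Finset.mem_univ m)] at hsplit
    rw [hint j x hx, ← Finset.add_sum_erase _ _ (Finset.mem_univ m)] at hsplit'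
    rw [Finset.sum_congr rfl fun m' hm' => by
      rw [Function.update_of_ne (Finset.ne_of_mem_erase hm')]] at hsplit'
    have h0 : tensorForm m (fun k l => G k j * Function.update (q j x) m 0 m l) (W - W') = 0 := by
      simp [tensorForm_apply]
    rw [h0, zero_add] at hsplit'
    rw [← hsplit', add_zero] at hsplit
    exact hsplit.symm
  have hli := hQ.2.1 m q hq
  simp only [response_single_message] at hli
  have hli' := LinearIndependent.of_comp (v := fun x : {x : (Σ j,
    Slot (SymMatrix.ofMessages N r M) M ρ j) // m ∈ x.2.1.2.2} =>
      fun k l => G k x.1.1 * q x.1.1 x.1.2 m l) (tensorForm m) hli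
  have h0 := eq_zero_of_tensorForm_eq_zero m hli'
    ((card_slots_involving hrN hM ρ m).trans hℓ.symm) (W := W - W')
    fun x => hdes x.1.1 x.1.2 x.2
  exact sub_eq_zero.1 h0

theorem Scheme.tPrivate_of_map_eq {F : Type} [Field F] [Fintype F] {N : ℕ} {ι : Fin N → Type}
    [∀ j, Fintype (ι j)] [∀ j, DecidableEq (ι j)] {M ℓ : ℕ} [NeZero M] {Q : Scheme F ι M ℓ} {T : ℕ}
    (h : ∀ J : Finset (Fin N), J.card = T → ∀ m m', (Q m).map (fun q (j : J) => q j) =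
      (Q m').map fun q (j : J) => q j) : Q.TPrivate T := by
  intro J hJ
  rw [← mutualInfo_bind_map_eq_zero ((Q 0).map fun q (j : J) => q j)
    (PMF.uniformOfFintype (Fin M))]
  congr 2
  ext1 m
  rw [h J hJ 0 m, PMF.map_comp]
  rfl

/-! ### The rate -/

theorem rate_eq {N r M ρ L D : ℕ} (hr : 1 ≤ r) (hrN : r < N) (hM : 2 ≤ M) (hρ : 0 < ρ)
    (hL : L = ρ * N ^ (M - 1)) (hD : (N - r) * D + ρ * r ^ M = ρ * N ^ M) :
    (L : ℝ) / D = ((N : ℝ) - r) * (N : ℝ) ^ (M - 1) / ((N : ℝ) ^ M - (r : ℝ) ^ M) ∧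
    (L : ℝ) / D = ((N : ℝ) - r) / (N * (1 - ((r : ℝ) / N) ^ M)) ∧
    ((N : ℝ) - r) / N < (L : ℝ) / D := by
  have hN : (0 : ℝ) < N := by exact_mod_cast (by omega : 0 < N)
  have hr' : (0 : ℝ) < r := by exact_mod_cast hr
  have hrN' : (r : ℝ) < N := by exact_mod_cast hrN
  have hρ' : (0 : ℝ) < ρ := by exact_mod_cast hρ
  have hpow : (r : ℝ) ^ M < (N : ℝ) ^ M := pow_lt_pow_left₀ hrN' hr'.le (by omega)
  have hD' : ((N : ℝ) - r) * D = ρ * ((N : ℝ) ^ M - (r : ℝ) ^ M) := by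
    have := congrArg (Nat.cast : ℕ → ℝ) hD
    push_cast [Nat.cast_sub hrN.le] at this
    linarith
  have hDpos : (0 : ℝ) < D := by
    have h1 : 0 < ((N : ℝ) - r) * D := by
      rw [hD']
      exact mul_pos hρ' (sub_pos.2 hpow)
    exact pos_of_mul_pos_right h1 (sub_pos.2 hrN').le
  have h1 : (L : ℝ) / D = ((N : ℝ) - r) * (N : ℝ) ^ (M - 1) / ((N : ℝ) ^ M - (r : ℝ) ^ M) := by
    rw [div_eq_div_iff hDpos.ne' (sub_pos.2 hpow).ne', hL]
    push_cast
    linear_combination -(N : ℝ) ^ (M - 1) * hD'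
  have hNM : (N : ℝ) ^ M = N * (N : ℝ) ^ (M - 1) := by
    rw [← pow_succ']
    congr 1
    omega
  have h2 : (L : ℝ) / D = ((N : ℝ) - r) / (N * (1 - ((r : ℝ) / N) ^ M)) := by
    have hq : (N : ℝ) * (1 - ((r : ℝ) / N) ^ M) * (N : ℝ) ^ (M - 1) =
        (N : ℝ) ^ M - (r : ℝ) ^ M := by
      rw [div_pow]
      field_simp
      rw [hNM]
      ring
    rw [h1, ← hq, mul_div_mul_right _ _ (pow_pos hN _).ne']
  refine ⟨h1, h2, ?_⟩
  rw [h2]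
  have hlt : ((r : ℝ) / N) ^ M < 1 :=
    pow_lt_one₀ (by positivity) ((div_lt_one hN).2 hrN') (by omega)
  have hpos : 0 < ((r : ℝ) / N) ^ M := by positivity
  refine div_lt_div_of_pos_left (sub_pos.2 hrN') (mul_pos hN (by linarith)) ?_
  nlinarith

/-! ### The lifting theorem -/

/-- One-shot schemes for all shifts that the blocks of `S_M` use: only the unshifted one occurs for
`M = 2`, and for `K = 1` all of them are obtained from it. -/
theorem exists_shifted_coeff {F : Type} [Field F] [Fintype F] {N K T r M ℓ : ℕ} [NeZero N]
    [NeZero M] (hK : 1 ≤ K) {G : Matrix (Fin K) (Fin N) F} (hG : IsMDS G)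
    (Q : OneShotScheme G T r (0 : Fin N) M ℓ)
    (hshift : 2 ≤ K → 3 ≤ M → ∀ c : Fin N, Nonempty (OneShotScheme G T r c M ℓ)) :
    ∃ β : Fin N → Fin N → Fin N → F, β 0 = Q.coeff ∧
      (3 ≤ M → ∀ c : Fin N, ∃ Qc : OneShotScheme G T r c M ℓ, Qc.coeff = β c) := by
  classical
  have hne : 3 ≤ M → ∀ c : Fin N, Nonempty (OneShotScheme G T r c M ℓ) := by
    intro hM c
    rcases Nat.lt_or_ge K 2 with h | h
    · exact Q.nonempty_shift (by omega) hG c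
    · exact hshift h hM c
  by_cases hM : 3 ≤ M
  · refine ⟨fun c => if c = 0 then Q.coeff else (hne hM c).some.coeff, if_pos rfl, fun _ c => ?_⟩
    by_cases hc : c = 0
    · subst hc
      exact ⟨Q, (if_pos rfl).symm⟩
    · exact ⟨_, (if_neg hc).symm⟩
  · exact ⟨fun _ => Q.coeff, rfl, fun h => absurd h hM⟩

theorem Block.offset_eq_zero_of_mem_two {N r : ℕ} [NeZero N] {B : Block N}
    (hB : B ∈ Block.ofMessages N r 2) : B.offset = 0 := by
  change B ∈ [(⟨1, 0, fun _ => 0⟩ : Block N)] at hB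
  rw [List.mem_singleton.1 hB]

theorem theorem1 {F : Type} [Field F] [Fintype F] {N K T r M ℓ : ℕ} [NeZero N] [NeZero M]
    (hK : 1 ≤ K) (hKN : K ≤ N) (hT : 1 ≤ T) (hTN : T ≤ N) (hr : r < N) (hM : 2 ≤ M)
    (G : Matrix (Fin K) (Fin N) F) (hG : IsMDS G)
    (Q : OneShotScheme G T r (0 : Fin N) M ℓ)
    (hshift : 2 ≤ K → 3 ≤ M → ∀ c : Fin N, Nonempty (OneShotScheme G T r c M ℓ)) :
    ∃ β : Fin N → Fin N → Fin N → F,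
      β 0 = Q.coeff ∧
      (3 ≤ M → ∀ c : Fin N, ∃ Qc : OneShotScheme G T r c M ℓ, Qc.coeff = β c) ∧
      ∃ (ρ ℓ' : ℕ) (Q' : Scheme F (Slot (SymMatrix.ofMessages N r M) M ρ) M ℓ'),
        0 < ρ ∧ K * ℓ' = ρ * N ^ (M - 1) ∧
        IsLifted G r M ℓ' ρ β Q' ∧
        Q'.IsPIR G T ∧
        Q'.rate K = ((N : ℝ) - r) * (N : ℝ) ^ (M - 1) / ((N : ℝ) ^ M - (r : ℝ) ^ M) ∧
        Q'.rate K = ((N : ℝ) - r) / (N * (1 - ((r : ℝ) / N) ^ M)) ∧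
        ((N : ℝ) - r) / N < Q'.rate K := by
  classical
  have hr1 : 1 ≤ r := Q.codimension_pos hK hKN hT hTN hr hM hG
  obtain ⟨β, hβ0, hβ⟩ := exists_shifted_coeff hK hG Q hshift
  refine ⟨β, hβ0, hβ, ?_⟩
  -- For `M = 2` only the offset `0` occurs, and `β c` need not come from a scheme for `c ≠ 0`.
  have hcode : ∀ c, ∃ A : Matrix (Fin N) (Fin N) F,
      ((∃ B ∈ Block.ofMessages N r M, B.offset = c) → ∀ i, A i ∈ decodingCode G r c (β c)) ∧
        ColsIndependent T A := by
    intro c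
    by_cases hc : ∃ B ∈ Block.ofMessages N r M, B.offset = c
    · have hs : HasStrength (decodingCode G r c (β c)) T := by
        rcases Nat.lt_or_ge M 3 with h | h
        · obtain ⟨B, hB, rfl⟩ := hc
          obtain rfl : M = 2 := by omega
          rw [Block.offset_eq_zero_of_mem_two hB, hβ0]
          exact Q.hasStrength hr hM
        · obtain ⟨Qc, hQc⟩ := hβ h c
          rw [← hQc]
          exact Qc.hasStrength hr hM
      obtain ⟨A, hA, hAT⟩ := hs.exists_matrix
      exact ⟨A, fun _ => hA, hAT⟩
    · exact ⟨1, fun h => absurd h hc, colsIndependent_one T⟩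
  choose A hA hAT using hcode
  obtain ⟨e, he, u, hu⟩ := Seed.exists_linearMaps hKN hG (N ^ (M - 2))
  choose φ hφ using fun m => exists_labels_desired (N := N) hr1 hr.le hM m
  have hlab : ∀ m m' : Fin M, ∃ (ψ : Fin N → ℕ × Finset (Fin M) → Fin (N ^ (M - 2)))
      (P : Fin (N ^ (M - 2)) → Matrix (Fin N) (Fin N) F),
      (∀ j, Set.InjOn (ψ j) ((SymMatrix.ofMessages N r M).slotsWith m' j)) ∧
      (∀ b, ColsIndependent T (P b)) ∧ (m' = m → P = fun _ => 1) ∧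
      (m' ≠ m → ∀ p ∈ blockPairs (Block.ofMessages N r M) m m', ∃ b,
        (∀ j, ψ j (Block.slot r m j p) = b) ∧
          ∀ i, P b i ∈ decodingCode G r p.1.offset (β p.1.offset)) := by
    intro m m'
    by_cases hm : m' = m
    · exact ⟨φ m', fun _ => 1, hφ m', fun _ => colsIndependent_one T, fun _ => rfl,
        fun h => absurd hm h⟩
    · obtain ⟨ψ, c, hψ, hc⟩ := exists_labels_interference (N := N) hr1 hr.le hM hm
      refine ⟨ψ, fun b => A (c b), hψ, fun b => hAT _, fun h => absurd h hm, fun _ p hp => ?_⟩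
      obtain ⟨b, hcb, hb⟩ := hc p hp
      have hA' : ∀ c', c' = p.1.offset → ∀ i,
          A c' i ∈ decodingCode G r p.1.offset (β p.1.offset) := by
        rintro _ rfl
        exact hA _ ⟨p.1, hp.1, rfl⟩
      exact ⟨b, hb, hA' _ hcb⟩
  choose ψ P hψ hP hP1 hPψ using hlab
  let n := N ^ (M - 2)
  have hfin : Finite ((Seed N K n → F) ≃ₗ[F] (Seed N K n → F)) :=
    DFunLike.finite _
  let _ : Fintype ((Seed N K n → F) ≃ₗ[F] (Seed N K n → F)) := Fintype.ofFinite _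
  let Q' : Scheme F (Slot (SymMatrix.ofMessages N r M) M (e * K)) M (e * (N * n)) := fun m =>
    (PMF.uniformOfFintype (Fin M → (Seed N K n → F) ≃ₗ[F] (Seed N K n → F))).map
      (liftQuery u (SymMatrix.ofMessages N r M) (P m) (ψ m))
  have hsupp : ∀ m, ∀ q ∈ (Q' m).support, ∃ g,
      liftQuery u (SymMatrix.ofMessages N r M) (P m) (ψ m) g = q := by
    intro m q hq
    rw [PMF.support_map] at hq
    obtain ⟨g, -, hg⟩ := hq
    exact ⟨g, hg⟩
  have hℓ : K * (e * (N * n)) = e * K * N ^ (M - 1) := by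
    rw [show M - 1 = M - 2 + 1 by omega, pow_succ]
    ring
  have hlift : IsLifted G r M (e * (N * n)) (e * K) β Q' := by
    refine ⟨fun m q hq j x => ?_, fun m q hq => ?_, fun m q hq B hB p I hm hI x hx i hi => ?_⟩
    · obtain ⟨g, rfl⟩ := hsupp m q hq
      exact isSumQuery_of_forall_eq_zero fun m' hm' => if_neg hm'
    · obtain ⟨g, rfl⟩ := hsupp m q hq
      exact linearIndependent_response_liftQuery (hu (g m)) (hP1 m m rfl) (hψ m m)
    · obtain ⟨g, rfl⟩ := hsupp m q hq
      exact response_liftQuery hm (fun m' hm' => hPψ m m' (fun h => hm (h ▸ hm')) (B, I)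
        ⟨hB, hm, hm', hI⟩) x hx hi
  have hpriv : Q'.TPrivate T := by
    refine Scheme.tPrivate_of_map_eq fun J hJ m m' => ?_
    simp only [Q', PMF.map_comp]
    exact map_liftQuery_restrict_eq u _ (hP m) (hP m') (hψ m) (hψ m') hJ
  have hrate := rate_eq hr1 hr hM (Nat.mul_pos he hK) hℓ (sum_card_slot (N := N) hr.le hM (e * K))
  exact ⟨e * K, e * (N * n), Q', Nat.mul_pos he hK, hℓ, hlift,
    ⟨hlift.correct hr1 hr.le hM hℓ, hpriv⟩, hrate⟩
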